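/- Let $\mathbf d=(\mathbf d_n)_{n\in\mathbb N}$, where $\mathbf d_n=(d_{n,1},\dots,d_{n,n})$ is a sequence of non-negative integers, let $n_{n,k}=|\{i\in[n]: d_{n,i}=k\}|$, and let $D_n$ be the degree of a uniformly random vertex, i.e. $\Pr(D_n=k)=n_{n,k}/n$. Assume that there is a probability distribution $D$ on $\{0,1,2,\dots\}$ such that (i) each $\mathbf d_n$ is feasible, i.e. it is the degree sequence of some simple graph with vertex set $[n]$; (ii) $D_n\to D$ in distribution; (iii) $\mathbb E[D_n]\to\mathbb E[D]<\infty$ and $\mathbb E[D_n^2]\to\mathbb E[D^2]<\infty$; (iv) if $\Pr(D=k)=0$ for some $k\ge 0$, then $n_{n,k}=0$ for all $n$. Let $\nu=\mathbb E[D(D-1)]/\mathbb E[D]$ (read as $\nu=0$ if $D=0$ almost surely), and assume $\nu<1$. Let $\mathbb{G}_n(\mathbf d_n)$ be a uniformly random simple graph with vertex set $[n]$ in which vertex $i$ has degree $d_{n,i}$ for every $i$. Let $\mathbb{CM}_n(\mathbf d_n)$ be the configuration model: the random multigraph on $[n]$ obtained by attaching $d_{n,i}$ half-edges to each vertex $i$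 and choosing a uniformly random perfect matching of all the half-edges, each matched pair being an edge between the vertices that its two half-edges are attached to. In a multigraph, a $1$-cycle is a loop, a $2$-cycle is a pair of parallel edges joining two distinct vertices, and $\ell$-cycles for $\ell\ge 3$ are defined as usual (cycles with different edge sets are different, parallel edges being distinguished). A multigraph is acyclic if it has no $\ell$-cycle for any $\ell\ge1$. Let $\mathbf a=(a_\ell)_{\ell}$ be any sequence of non-negative integers with $\sum_{\ell} a_\ell<\infty$. Then: (1) $$\lim_{n\to\infty}\Pr\big(\mathbb{CM}_n(\mathbf d_n)\text{ contains exactly } a_\ell\ \ell\text{-cycles for all }\ell\ge 1\big)=\sqrt{1-\nu}\,\prod_{\ell\ge 1}\frac{(\nu^\ell/2\ell)^{a_\ell}}{a_\ell!},$$ and in particular $\lim_{n\to\infty}\Pr(\mathbb{CM}_n(\mathbf d_n)\text{ is acyclic})=\sqrt{1-\nu}$. (2) $$\lim_{n\to\infty}\Pr\big(\mathbb{G}_n(\mathbf d_n)\text{ contains exactly } a_\ell\ \ell\text{-cycles for all }\ell\ge 3\big)=\sqrt{1-\nu}\; e^{\frac{\nu}{2}+\frac{\nu^2}{4}}\,\prod_{\ell\ge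 3}\frac{(\nu^\ell/2\ell)^{a_\ell}}{a_\ell!},$$ and in particular $\lim_{n\to\infty}\Pr(\mathbb{G}_n(\mathbf d_n)\text{ is acyclic})=\sqrt{1-\nu}\; e^{\frac{\nu}{2}+\frac{\nu^2}{4}}$. Here $0^0=1$. -/

import Mathlib

open Filter Topology
open scoped Nat

noncomputable section

namespace DegSeq

/-- The probability that a uniformly random element of the (finite, non-empty) set `S` of a finite
type has the property `p`. -/
def uniformProb {Ω : Type*} (S : Set Ω) (p : Ω → Prop) : ℝ :=
  ({ω | ω ∈ S ∧ p ω}.ncard : ℝ) / (S.ncard : ℝ)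

/-! ### Simple graphs with a given degree sequence -/

open scoped Classical in
/-- The simple graphs with vertex set `Fin n` in which every vertex `v` has degree `d v`.
The random graph `𝔾ₙ(d)` is a uniform element of this set. -/
def simpleGraphs {n : ℕ} (d : Fin n → ℕ) : Set (SimpleGraph (Fin n)) :=
  {G | ∀ v, G.degree v = d v}

/-- A degree sequence is feasible if it is the degree sequence of some simple graph. (This
implies `d v < n` for all `v` and that the sum of the `d v` is even.) -/
def Feasible {n : ℕ} (d : Fin n → ℕ) : Prop := (simpleGraphs d).Nonempty

/-! ### The configuration model -/

/-- The half-edges: `d v` of them are attached to each vertex `v`, and the half-edge `⟨v, i⟩` is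
incident to `v`. -/
abbrev HalfEdge {n : ℕ} (d : Fin n → ℕ) : Type := (v : Fin n) × Fin (d v)

/-- A set `M` of unordered pairs is a perfect matching of `α` if each of its members consists of
two different elements and each element of `α` lies in exactly one member. -/
def IsPerfectMatching {α : Type*} (M : Set (Sym2 α)) : Prop :=
  (∀ e ∈ M, ¬ e.IsDiag) ∧ ∀ h : α, ∃! e, e ∈ M ∧ h ∈ e

/-- The perfect matchings of the half-edges. The configuration model `ℂ𝕄ₙ(d)` is a uniform element
of this set. -/
def configurations {n : ℕ} (d : Fin n → ℕ) : Set (Set (Sym2 (HalfEdge d))) :=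
  {M | IsPerfectMatching M}

/-- The underlying multigraph of a configuration `M`: the vertex set is `Fin n`, and each matched
pair of half-edges is an edge joining the vertices that its two half-edges are incident to. -/
def multigraph {n : ℕ} {d : Fin n → ℕ} (M : Set (Sym2 (HalfEdge d))) :
    Graph (Fin n) (Sym2 (HalfEdge d)) where
  vertexSet := Set.univ
  edgeSet := M
  IsLink e x y := e ∈ M ∧ e.map Sigma.fst = s(x, y)
  isLink_symm := fun _ _ => ⟨fun _ _ h => ⟨h.1, h.2.trans Sym2.eq_swap⟩⟩
  eq_or_eq_of_isLink_of_isLink := by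
    rintro e x y v w ⟨-, h⟩ ⟨-, h'⟩
    have h0 := h.symm.trans h'
    rw [Sym2.eq_iff] at h0
    rcases h0 with h0 | h0
    · exact Or.inl h0.1
    · exact Or.inr h0.1
  edge_mem_iff_exists_isLink := by
    intro e
    constructor
    · intro he
      obtain ⟨x, y, hxy⟩ : ∃ x y, e.map Sigma.fst = s(x, y) := by
        induction e with
        | _ a b => exact ⟨a.1, b.1, rfl⟩
      exact ⟨x, y, he, hxy⟩
    · rintro ⟨x, y, h, -⟩
      exact h
  left_mem_of_isLink := fun _ _ _ _ => Set.mem_univ _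

/-- `C` is the edge set of a `k`-cycle of the multigraph `G`: there are `k` distinct vertices
`v₀, …, vₖ₋₁` and `k` distinct edges `e₀, …, eₖ₋₁` (the elements of `C`) such that `eᵢ` joins `vᵢ`
and `vᵢ₊₁`, indices being taken modulo `k`. Thus a `1`-cycle is a loop and a `2`-cycle is a pair of
parallel edges between two different vertices. Only used for `1 ≤ k`. -/
def IsCycleEdgeSet {V E : Type*} (G : Graph V E) (k : ℕ) (C : Set E) : Prop :=
  ∃ (v : Fin k → V) (e : Fin k → E), Function.Injective v ∧ Function.Injective e ∧
    Set.range e = C ∧ ∀ i, G.IsLink (e i) (v i) (v (finRotate k i))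

/-- The number of `k`-cycles in the multigraph `G` (with finitely many edges). -/
def numCycles {V E : Type*} (G : Graph V E) (k : ℕ) : ℕ :=
  {C : Set E | IsCycleEdgeSet G k C}.ncard

/-- A multigraph is acyclic if it has no cycle; in particular no loop and no multiple edge. -/
def IsAcyclicMultigraph {V E : Type*} (G : Graph V E) : Prop :=
  ∀ k, 1 ≤ k → ∀ C : Set E, ¬ IsCycleEdgeSet G k C

/-! ### Sequences of degree sequences and their limiting degree distribution -/

/-- `n_{n,k}`, the number of vertices of degree `k`. -/
def degreeCount {n : ℕ} (d : Fin n → ℕ) (k : ℕ) : ℕ := {v | d v = k}.ncard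

/-- `𝔼[f(D)]` for a random variable `D` with distribution `D` on the non-negative integers. -/
def expect (D : PMF ℕ) (f : ℕ → ℝ) : ℝ := ∑' k, (D k).toReal * f k

/-- `𝔼[f(Dₙ)]` where `Dₙ` is the degree of a uniformly random vertex. -/
def empiricalExpect {n : ℕ} (d : Fin n → ℕ) (f : ℕ → ℝ) : ℝ := (∑ v, f (d v)) / n

/-- The standing assumption on a sequence of degree sequences `d = (dₙ)`, with limiting degree
distribution `D`. -/
structure Assumption (d : (n : ℕ) → Fin n → ℕ) (D : PMF ℕ) : Prop where
  /-- Every `dₙ` is feasible. -/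
  feasible : ∀ n, Feasible (d n)
  /-- `Dₙ → D` in distribution; the variables being integer-valued, this is convergence of
  `ℙ(Dₙ = k) = n_{n,k} / n` to `ℙ(D = k)` for each `k`. -/
  tendsto_distr : ∀ k, Tendsto (fun n : ℕ => (degreeCount (d n) k : ℝ) / n) atTop
    (𝓝 (D k).toReal)
  /-- `D` has a finite second moment (hence also a finite mean). -/
  summable_sq : Summable fun k : ℕ => (D k).toReal * (k : ℝ) ^ 2
  /-- `𝔼[Dₙ] → 𝔼[D]`. -/
  tendsto_mean : Tendsto (fun n => empiricalExpect (d n) fun k => (k : ℝ)) atTop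
    (𝓝 (expect D fun k => (k : ℝ)))
  /-- `𝔼[Dₙ²] → 𝔼[D²]`. -/
  tendsto_sq : Tendsto (fun n => empiricalExpect (d n) fun k => (k : ℝ) ^ 2) atTop
    (𝓝 (expect D fun k => (k : ℝ) ^ 2))
  /-- Degrees that have probability zero under `D` do not occur at all. -/
  degreeCount_eq_zero : ∀ k, D k = 0 → ∀ n, degreeCount (d n) k = 0

/-- `ν = 𝔼[D(D-1)] / 𝔼[D]`. If `D = 0` almost surely (which under the assumption means that there
are no edges at all) this is `0`. -/
def nu (D : PMF ℕ) : ℝ :=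
  expect D (fun k => (k : ℝ) * ((k : ℝ) - 1)) / expect D (fun k => (k : ℝ))

end DegSeq

end

noncomputable section

namespace DegSeq

/-! The proof is the method of moments. Let `m` be the number of half-edges, `Δ` the largest degree
and `S` the number of corners, i.e. of ordered pairs of different half-edges at one vertex. A cycle
of length `l` is a cyclic family of `l` corners at different vertices, the second half-edge of each
being matched with the first of the next. It arises from exactly `2 * l` such families
(`card_rep_edges_eq`). A family of `k` corners prescribes `k` disjoint pairs, which all occur with
probability about `m ^ (-k)` (`card_matching`). There are about `S ^ k` families, because `Δ ^ 2 /
m` tends to 0, so the expected number of families that occur tends to `ν ^ k`.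

Overlapping cycles would spoil the factorial moments of the cycle counts. Only isolated cycles,
which meet no other cycle with a length in a fixed finite set `A`, are therefore counted at first.
Different isolated cycles are vertex-disjoint, so their joint factorial moments count families of
corners exactly (`card_isGood`). If a cycle is not isolated, there is an ear, a path that leaves the
family and returns to it; the expected number of families with an ear is `O(Δ ^ 2 / m)`
(`avg_card_ear_le`). Hence the factorial moments converge to those of independent Poisson variables
with means `ν ^ l / (2 * l)`, and isolated cycles may be replaced by all cycles.

Two passages to the limit, the inclusion-exclusion series and the step from finitely many lengths to
all, rest on one estimate: from some `n` on, the expected number of families of `k` corners is at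
most `ρ ^ k` for every `k`, with a fixed `ρ < 1` (`card_rep_mul_pairProb_le`). The factors `exp (-ν
^ l / (2 * l))` multiply to `√(1 - ν)`.

Every simple graph with the given degrees comes from the same number `∏ v, (d v)!` of
configurations. The random simple graph is therefore the configuration model conditioned on having
no 1- or 2-cycles, an event with limiting probability `exp (-(ν / 2 + ν ^ 2 / 4))`, and part (2) is
a quotient of two limits. -/

theorem card_eq_card_mul_of_fiber {α β : Type*} [Finite α] [Finite β] (F : α → β) (k : ℕ)
    (h : ∀ b, Nat.card {a // F a = b} = k) : Nat.card α = Nat.card β * k := by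
  classical
  have := Fintype.ofFinite α
  have := Fintype.ofFinite β
  rw [Nat.card_congr (Equiv.sigmaFiberEquiv F).symm, Nat.card_sigma, Finset.sum_congr rfl
    (fun b _ => h b)]
  simp

/-! ### Perfect matchings -/

section Matching
variable {α : Type*} {M : Set (Sym2 α)}

theorem IsPerfectMatching.ne (hM : IsPerfectMatching M) {a b : α} (h : s(a, b) ∈ M) : a ≠ b :=
  fun hab => hM.1 _ h (by simpa using hab)

theorem IsPerfectMatching.eq_right (hM : IsPerfectMatching M) {a b c : α} (h : s(a, b) ∈ M)
    (h' : s(a, c) ∈ M) : b = c := by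
  have := (hM.2 a).unique ⟨h, Sym2.mem_mk_left _ _⟩ ⟨h', Sym2.mem_mk_left _ _⟩
  exact Sym2.congr_right.1 this

theorem IsPerfectMatching.exists_partner (hM : IsPerfectMatching M) (a : α) :
    ∃ b, s(a, b) ∈ M := by
  obtain ⟨e, ⟨he, hae⟩, -⟩ := hM.2 a
  obtain ⟨b, rfl⟩ := Sym2.mem_iff_exists.1 hae
  exact ⟨b, he⟩

/-- The partner of an element in a perfect matching. -/
def IsPerfectMatching.partner (hM : IsPerfectMatching M) (a : α) : α := (hM.exists_partner a).choose

theorem IsPerfectMatching.mk_partner_mem (hM : IsPerfectMatching M) (a : α) :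
    s(a, hM.partner a) ∈ M := (hM.exists_partner a).choose_spec

theorem IsPerfectMatching.partner_eq_iff (hM : IsPerfectMatching M) {a b : α} :
    hM.partner a = b ↔ s(a, b) ∈ M :=
  ⟨fun h => h ▸ hM.mk_partner_mem a, fun h => hM.eq_right (hM.mk_partner_mem a) h⟩

theorem IsPerfectMatching.preimage (hM : IsPerfectMatching M) (τ : α ≃ α) :
    IsPerfectMatching (Sym2.map τ ⁻¹' M) := by
  refine ⟨fun e he hd => ?_, fun a => ?_⟩
  · refine hM.1 _ he ?_
    induction e with
    | _ a b =>
      have : a = b := by simpa using hd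
      simp [this]
  · refine ⟨s(a, τ.symm (hM.partner (τ a))), ⟨?_, Sym2.mem_mk_left _ _⟩, ?_⟩
    · simpa using hM.mk_partner_mem (τ a)
    · rintro e ⟨he, hae⟩
      obtain ⟨b, rfl⟩ := Sym2.mem_iff_exists.1 hae
      have : s(τ a, τ b) ∈ M := by simpa using he
      rw [hM.partner_eq_iff.2 this]
      simp

variable (α) in
/-- The type of perfect matchings of `α`. -/
abbrev PerfectMatching : Type _ := {M : Set (Sym2 α) // IsPerfectMatching M}

instance [Finite α] : Finite (PerfectMatching α) := Subtype.finite

instance [Finite α] : Fintype (PerfectMatching α) := Fintype.ofFinite _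

variable [Finite α]

theorem card_matching_relabel_le {J : Type*} (u w : J → α) (τ : α ≃ α) :
    Nat.card {M : PerfectMatching α // ∀ j, s(τ (u j), τ (w j)) ∈ M.1} ≤
      Nat.card {M : PerfectMatching α // ∀ j, s(u j, w j) ∈ M.1} := by
  refine Nat.card_le_card_of_injective
    (fun M => ⟨⟨_, M.1.2.preimage τ⟩, fun j => by simpa using M.2 j⟩) ?_
  intro M M' h
  have hs : Function.Surjective (Sym2.map τ) := by
    intro e
    exact ⟨e.map τ.symm, by rw [Sym2.map_map]; simp⟩
  have h1 : Sym2.map τ ⁻¹' M.1.1 = Sym2.map τ ⁻¹' M'.1.1 := by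
    simpa using h
  exact Subtype.ext (Subtype.ext (Set.preimage_injective.2 hs h1))

/-- Permutations act on perfect matchings, so this count depends only on the pattern of the
prescribed pairs. -/
theorem card_matching_relabel {J : Type*} (u w u' w' : J → α) (τ : α ≃ α)
    (hu : ∀ j, τ (u j) = u' j) (hw : ∀ j, τ (w j) = w' j) :
    Nat.card {M : PerfectMatching α // ∀ j, s(u j, w j) ∈ M.1} =
      Nat.card {M : PerfectMatching α // ∀ j, s(u' j, w' j) ∈ M.1} := by
  apply le_antisymm
  · have := card_matching_relabel_le u' w' τ.symm
    simpa [← hu, ← hw] using this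
  · have := card_matching_relabel_le u w τ
    simpa [← hu, ← hw] using this

/-- Sort the matchings with the first `k` pairs by the partner of the last `u`. Any element outside
the `2 * k + 1` already named can be that partner, and a transposition shows that all choices are
equally frequent. -/
theorem card_matching_snoc {k : ℕ} (u w : Fin (k + 1) → α)
    (h : Function.Injective (Sum.elim u w)) :
    Nat.card {M : PerfectMatching α // ∀ j : Fin k, s(u j.castSucc, w j.castSucc) ∈ M.1} =
      (Nat.card α - (2 * k + 1)) *
        Nat.card {M : PerfectMatching α // ∀ j, s(u j, w j) ∈ M.1} := by
  classical
  have hu : Function.Injective u := h.comp Sum.inl_injective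
  have hw : Function.Injective w := h.comp Sum.inr_injective
  have huw : ∀ i j, u i ≠ w j := fun i j hij => by simpa using @h (.inl i) (.inr j) hij
  -- `T` lists the elements that cannot be the partner: the last `u` itself and the ends of the
  -- first `k` pairs.
  let T : Option (Fin k ⊕ Fin k) → α
    | none => u (Fin.last k)
    | some (.inl j) => u j.castSucc
    | some (.inr j) => w j.castSucc
  have hT : Function.Injective T := by
    rintro (_ | (i | i)) (_ | (j | j)) hij
    all_goals
      simp only [T] at hij
      first
        | rfl
        | exact (huw _ _ hij).elim
        | exact (huw _ _ hij.symm).elim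
        | (have := hu hij; simp [Fin.ext_iff] at this ⊢; try omega)
        | (have := hw hij; simp [Fin.ext_iff] at this ⊢; try omega)
  have hB : Nat.card {b // b ∉ Set.range T} = Nat.card α - (2 * k + 1) := by
    have : Nat.card (Set.range T) = 2 * k + 1 := by
      rw [Nat.card_range_of_injective hT]; simp; ring
    have h2 := Set.ncard_add_ncard_compl (Set.range T)
    rw [← Nat.card_coe_set_eq, ← Nat.card_coe_set_eq, this] at h2
    change Nat.card ((Set.range T)ᶜ : Set α) = _
    omega
  rw [← hB]
  let F : {M : PerfectMatching α // ∀ j : Fin k, s(u j.castSucc, w j.castSucc) ∈ M.1} →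
      {b // b ∉ Set.range T} := fun M => ⟨M.1.2.partner (u (Fin.last k)), by
    rintro ⟨x, hx⟩
    have h1 := M.1.2.mk_partner_mem (u (Fin.last k))
    rw [← hx] at h1
    rcases x with _ | (j | j)
    · exact M.1.2.ne h1 rfl
    · have h2 := M.1.2.eq_right (Sym2.eq_swap ▸ h1) (M.2 j)
      exact huw _ _ h2
    · have h2 := M.1.2.eq_right (Sym2.eq_swap ▸ h1) (Sym2.eq_swap ▸ M.2 j)
      have := hu h2
      simp [Fin.ext_iff] at this
      omega⟩
  refine card_eq_card_mul_of_fiber F _ ?_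
  rintro ⟨b, hb⟩
  have key : Nat.card {M : PerfectMatching α // ∀ j, s(u j, Fin.snoc (α := fun _ => α)
      (fun j => w j.castSucc) b j) ∈ M.1} =
      Nat.card {M : PerfectMatching α // ∀ j, s(u j, w j) ∈ M.1} := by
    apply card_matching_relabel _ _ _ _ (Equiv.swap b (w (Fin.last k)))
    · intro j
      apply Equiv.swap_apply_of_ne_of_ne _ (huw _ _)
      rintro rfl
      apply hb
      induction j using Fin.lastCases with
      | last => exact ⟨none, rfl⟩
      | cast j => exact ⟨some (.inl j), rfl⟩
    · intro j
      induction j using Fin.lastCases with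
      | last => simp
      | cast j =>
        simp only [Fin.snoc_castSucc]
        apply Equiv.swap_apply_of_ne_of_ne
        · rintro rfl
          exact hb ⟨some (.inr j), rfl⟩
        · intro hh
          have := hw hh
          simp [Fin.ext_iff] at this
          omega
  rw [← key]
  refine Nat.card_congr
    { toFun := fun M => ⟨M.1.1, fun j => ?_⟩
      invFun := fun M => ⟨⟨M.1, fun j => ?_⟩, ?_⟩
      left_inv := fun _ => rfl
      right_inv := fun _ => rfl }
  · induction j using Fin.lastCases with
    | last => simpa [F, IsPerfectMatching.partner_eq_iff] using M.2
    | cast j => simpa using M.1.2 j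
  · simpa using M.2 j.castSucc
  · simpa [F, IsPerfectMatching.partner_eq_iff] using M.2 (Fin.last k)

/-- The probability that `k` given disjoint pairs belong to a uniformly random perfect matching of
`m` elements. -/
def pairProb (m k : ℕ) : ℝ := ∏ i ∈ Finset.range k, ((m : ℝ) - (2 * i + 1))⁻¹

theorem card_matching_fin [Nonempty (PerfectMatching α)] {k : ℕ} (u w : Fin k → α)
    (h : Function.Injective (Sum.elim u w)) :
    (Nat.card {M : PerfectMatching α // ∀ j, s(u j, w j) ∈ M.1} : ℝ) =
      Nat.card (PerfectMatching α) * pairProb (Nat.card α) k := by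
  induction k with
  | zero =>
    simp only [pairProb, Finset.range_zero, Finset.prod_empty, mul_one, Nat.cast_inj]
    exact Nat.card_congr (Equiv.subtypeUnivEquiv fun M j => j.elim0)
  | succ k ih =>
    have h1 := ih (fun j => u j.castSucc) (fun j => w j.castSucc) (by
      have : Function.Injective (Sum.map Fin.castSucc Fin.castSucc :
          Fin k ⊕ Fin k → Fin (k + 1) ⊕ Fin (k + 1)) :=
        Sum.map_injective.2 ⟨Fin.castSucc_injective _, Fin.castSucc_injective _⟩
      have h2 := h.comp this
      rwa [Sum.elim_comp_map] at h2)
    rw [card_matching_snoc u w h] at h1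
    have h3 : 2 * k + 2 ≤ Nat.card α := by
      have := Nat.card_le_card_of_injective _ h
      simp at this
      omega
    rw [pairProb, Finset.prod_range_succ, ← pairProb, ← mul_assoc, ← h1, Nat.cast_mul,
      Nat.cast_sub (by omega)]
    have : ((Nat.card α : ℝ) - (2 * k + 1)) ≠ 0 := by
      have : ((2 * k + 2 : ℕ) : ℝ) ≤ Nat.card α := by exact_mod_cast h3
      push_cast at this
      intro h4
      linarith
    push_cast
    field_simp

theorem card_matching {J : Type*} [Finite J] [Nonempty (PerfectMatching α)] (u w : J → α)
    (h : Function.Injective (Sum.elim u w)) :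
    (Nat.card {M : PerfectMatching α // ∀ j, s(u j, w j) ∈ M.1} : ℝ) =
      Nat.card (PerfectMatching α) * pairProb (Nat.card α) (Nat.card J) := by
  let e := Finite.equivFin J
  rw [← card_matching_fin (fun j => u (e.symm j)) (fun j => w (e.symm j))]
  · congr 1
    exact Nat.card_congr (Equiv.subtypeEquivRight fun M =>
      (e.symm.forall_congr_right (q := fun j => s(u j, w j) ∈ M.1)).symm)
  · have := h.comp (Sum.map_injective.2 ⟨e.symm.injective, e.symm.injective⟩)
    rwa [Sum.elim_comp_map] at this

end Matching

/-! ### Averages -/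

section Avg
variable {Ω : Type*} [Fintype Ω]

/-- The average of a function on a finite type. -/
def avg (F : Ω → ℝ) : ℝ := (∑ ω, F ω) / Nat.card Ω

theorem avg_add (F G : Ω → ℝ) : avg (fun ω => F ω + G ω) = avg F + avg G := by
  simp [avg, Finset.sum_add_distrib, add_div]

theorem avg_sum {ι : Type*} (s : Finset ι) (F : ι → Ω → ℝ) :
    avg (fun ω => ∑ i ∈ s, F i ω) = ∑ i ∈ s, avg (F i) := by
  simp only [avg]
  rw [Finset.sum_comm, Finset.sum_div]

theorem avg_const_mul (c : ℝ) (F : Ω → ℝ) : avg (fun ω => c * F ω) = c * avg F := by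
  simp [avg, ← Finset.mul_sum, mul_div_assoc]

theorem avg_mono {F G : Ω → ℝ} (h : ∀ ω, F ω ≤ G ω) : avg F ≤ avg G :=
  div_le_div_of_nonneg_right (Finset.sum_le_sum fun ω _ => h ω) (Nat.cast_nonneg _)

theorem avg_nonneg {F : Ω → ℝ} (h : ∀ ω, 0 ≤ F ω) : 0 ≤ avg F :=
  div_nonneg (Finset.sum_nonneg fun ω _ => h ω) (Nat.cast_nonneg _)

/-- Exchanging the order of counting in an average of a number of objects. -/
theorem avg_card_subtype {X : Type*} [Finite X] (P : Ω → X → Prop) :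
    avg (fun ω => (Nat.card {x // P ω x} : ℝ)) =
      (∑ᶠ x, (Nat.card {ω // P ω x} : ℝ)) / Nat.card Ω := by
  classical
  have := Fintype.ofFinite X
  rw [avg, finsum_eq_sum_of_fintype]
  congr 1
  simp only [Nat.card_eq_fintype_card, Fintype.card_subtype, Finset.card_filter, Nat.cast_sum]
  exact Finset.sum_comm

theorem avg_card_subtype_le {X : Type*} [Finite X] (P : Ω → X → Prop) (p : ℝ)
    (h : ∀ x, (Nat.card {ω // P ω x} : ℝ) ≤ Nat.card Ω * p) (hΩ : Nonempty Ω) :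
    avg (fun ω => (Nat.card {x // P ω x} : ℝ)) ≤ Nat.card X * p := by
  have := Fintype.ofFinite X
  have h0 : (0 : ℝ) < Nat.card Ω := by exact_mod_cast Nat.card_pos
  rw [avg_card_subtype, finsum_eq_sum_of_fintype, div_le_iff₀ h0]
  refine (Finset.sum_le_sum fun x _ => h x).trans ?_
  rw [Finset.sum_const, Finset.card_univ, ← Nat.card_eq_fintype_card]
  simp only [nsmul_eq_mul]
  exact le_of_eq (by ring)

theorem avg_card_subtype_eq {X : Type*} [Finite X] (P : Ω → X → Prop) (p : ℝ)
    (h : ∀ x, (Nat.card {ω // P ω x} : ℝ) = Nat.card Ω * p) (hΩ : Nonempty Ω) :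
    avg (fun ω => (Nat.card {x // P ω x} : ℝ)) = Nat.card X * p := by
  have := Fintype.ofFinite X
  have h0 : (0 : ℝ) < Nat.card Ω := by exact_mod_cast Nat.card_pos
  rw [avg_card_subtype, finsum_eq_sum_of_fintype, div_eq_iff h0.ne',
    Finset.sum_congr rfl fun x _ => h x]
  rw [Finset.sum_const, Finset.card_univ, ← Nat.card_eq_fintype_card]
  simp only [nsmul_eq_mul]
  ring

end Avg

/-! ### Corners and families of corners -/

section Corner
variable {H V : Type*} (π : H → V)

/-- An ordered pair of different half-edges at the same vertex. -/
def Corner : Type _ := {x : H × H // π x.1 = π x.2 ∧ x.1 ≠ x.2}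

variable {π}

/-- The first half-edge of a corner. -/
def Corner.inn (x : Corner π) : H := x.1.1
/-- The second half-edge of a corner. -/
def Corner.out (x : Corner π) : H := x.1.2
/-- The vertex of a corner. -/
def Corner.vert (x : Corner π) : V := π x.inn

theorem Corner.map_inn (x : Corner π) : π x.inn = x.vert := rfl
theorem Corner.map_out (x : Corner π) : π x.out = x.vert := x.2.1.symm
theorem Corner.inn_ne_out (x : Corner π) : x.inn ≠ x.out := x.2.2

theorem Corner.ext {x y : Corner π} (h : x.inn = y.inn) (h' : x.out = y.out) : x = y :=
  Subtype.ext (Prod.ext h h')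

/-- The corner with given half-edges. -/
def Corner.mk (a b : H) (h : π a = π b) (h' : a ≠ b) : Corner π := ⟨(a, b), h, h'⟩

/-- The corner with the two half-edges exchanged. -/
def Corner.swap (x : Corner π) : Corner π := ⟨(x.1.2, x.1.1), x.2.1.symm, x.2.2.symm⟩

@[simp] theorem Corner.inn_mk (a b : H) (h : π a = π b) (h' : a ≠ b) :
    (Corner.mk a b h h').inn = a := rfl
@[simp] theorem Corner.out_mk (a b : H) (h : π a = π b) (h' : a ≠ b) :
    (Corner.mk a b h h').out = b := rfl
@[simp] theorem Corner.inn_swap (x : Corner π) : x.swap.inn = x.out := rfl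
@[simp] theorem Corner.out_swap (x : Corner π) : x.swap.out = x.inn := rfl
@[simp] theorem Corner.vert_swap (x : Corner π) : x.swap.vert = x.vert := x.map_out

instance [Finite H] : Finite (Corner π) := Subtype.finite

variable (π) in
/-- Families of corners at different vertices. -/
abbrev Rep (I : Type*) : Type _ := {f : I → Corner π // Function.Injective fun i => (f i).vert}

instance [Finite H] {I : Type*} [Finite I] : Finite (Rep π I) := Subtype.finite

instance {I : Type*} : CoeFun (Rep π I) (fun _ => I → Corner π) := ⟨Subtype.val⟩

theorem Rep.inn_injective {I : Type*} (f : Rep π I) : Function.Injective fun i => (f i).inn :=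
  fun _ _ h => f.2 (congrArg π h)

theorem Rep.out_injective {I : Type*} (f : Rep π I) : Function.Injective fun i => (f i).out :=
  fun i j h => f.2 (by simpa [Corner.map_out] using congrArg π h)

theorem Rep.inn_ne_out {I : Type*} (f : Rep π I) (i j : I) : (f i).inn ≠ (f j).out := by
  intro h
  have : i = j := f.2 (by simpa [Corner.map_out, Corner.map_inn] using congrArg π h)
  subst this
  exact (f i).inn_ne_out h

theorem Rep.elim_injective {I : Type*} (f : Rep π I) :
    Function.Injective (Sum.elim (fun i => (f i).out) fun i => (f i).inn) :=
  Function.Injective.sumElim f.out_injective f.inn_injective fun i j h => f.inn_ne_out j i h.symm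

theorem card_rep_congr {I J : Type*} (e : I ≃ J) : Nat.card (Rep π I) = Nat.card (Rep π J) := by
  refine Nat.card_congr (Equiv.subtypeEquiv (e.arrowCongr (Equiv.refl _)) fun f => ?_)
  constructor
  · intro h
    exact h.comp e.symm.injective
  · intro h
    have := h.comp e.injective
    simpa [Function.comp_def] using this

/-- Families of `k + 1` corners, as a family of `k` corners and one more. -/
def repSucc (k : ℕ) : Rep π (Fin (k + 1)) ≃
    Σ f : Rep π (Fin k), {x : Corner π // ∀ i, x.vert ≠ (f i).vert} where
  toFun f := ⟨⟨fun i => f i.succ, fun i j h => Fin.succ_injective _ (f.2 h)⟩,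
    ⟨f 0, fun i h => (Fin.succ_ne_zero i) (f.2 h).symm⟩⟩
  invFun g := ⟨Fin.cons g.2.1 g.1.1, by
    intro i j
    induction i using Fin.cases with
    | zero =>
      induction j using Fin.cases with
      | zero => simp
      | succ j => intro h; exact (g.2.2 j (by simpa using h)).elim
    | succ i =>
      induction j using Fin.cases with
      | zero => intro h; exact (g.2.2 i (by simpa using h.symm)).elim
      | succ j => intro h; exact congrArg Fin.succ (g.1.2 (by simpa using h))⟩
  left_inv f := by
    apply Subtype.ext
    funext i
    induction i using Fin.cases <;> rfl
  right_inv g := rfl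

theorem card_rep_zero : Nat.card (Rep π (Fin 0)) = 1 := by
  have : Unique (Rep π (Fin 0)) :=
    { default := ⟨fun i => i.elim0, fun i => i.elim0⟩
      uniq := fun f => Subtype.ext (funext fun i => i.elim0) }
  exact Nat.card_unique

variable [Finite H]

/-- A new corner must avoid the `k` chosen corners and their `k` reversals. The saving of `2 * k`
matches the decrease of the denominators in `pairProb`. -/
theorem card_rep_succ_le (k : ℕ) :
    Nat.card (Rep π (Fin (k + 1))) ≤ Nat.card (Rep π (Fin k)) * (Nat.card (Corner π) - 2 * k) := by
  have := Fintype.ofFinite (Rep π (Fin k))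
  rw [Nat.card_congr (repSucc k), Nat.card_sigma]
  refine (Finset.sum_le_card_nsmul _ _ (Nat.card (Corner π) - 2 * k) fun f _ => ?_).trans ?_
  · have hinj : Function.Injective (Sum.elim f.1 fun i => (f i).swap) := by
      refine Function.Injective.sumElim (fun i j h => f.2 (by simp [h])) (fun i j h => ?_)
        fun i j h => ?_
      · exact f.2 (by simpa using congrArg Corner.vert h)
      · exact f.inn_ne_out i j (by simpa using congrArg Corner.inn h)
    have h2 := Set.ncard_add_ncard_compl (Set.range (Sum.elim f.1 fun i => (f i).swap))
    rw [← Nat.card_coe_set_eq, Nat.card_range_of_injective hinj] at h2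
    have h3 : Nat.card {x : Corner π // ∀ i, x.vert ≠ (f i).vert} ≤
        (Set.range (Sum.elim f.1 fun i => (f i).swap))ᶜ.ncard := by
      rw [← Nat.card_coe_set_eq]
      refine Nat.card_mono (Set.toFinite _) ?_
      rintro x hx ⟨i | i, rfl⟩
      · exact hx i rfl
      · exact hx i (by simp)
    simp only [Nat.card_sum, Nat.card_fin] at h2
    omega
  · simp [Nat.card_eq_fintype_card, Finset.card_univ]

/-- The vertex of each chosen corner rules out at most `Δ ^ 2` corners. -/
theorem card_rep_succ_ge (k Δ : ℕ) (hΔ : ∀ v, Nat.card {h // π h = v} ≤ Δ) :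
    Nat.card (Rep π (Fin k)) * (Nat.card (Corner π) - k * Δ ^ 2) ≤
      Nat.card (Rep π (Fin (k + 1))) := by
  have := Fintype.ofFinite (Rep π (Fin k))
  rw [Nat.card_congr (repSucc k), Nat.card_sigma]
  have key : ∀ f : Rep π (Fin k), Nat.card (Corner π) - k * Δ ^ 2 ≤
      Nat.card {x : Corner π // ∀ i, x.vert ≠ (f i).vert} := by
    intro f
    have h2 := Set.ncard_add_ncard_compl {x : Corner π | ∀ i, x.vert ≠ (f i).vert}
    have h3 : {x : Corner π | ∀ i, x.vert ≠ (f i).vert}ᶜ.ncard ≤ k * Δ ^ 2 := by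
      rw [← Nat.card_coe_set_eq]
      have hle : Nat.card (Σ i : Fin k, {h // π h = (f i).vert} × {h // π h = (f i).vert}) ≤
          k * Δ ^ 2 := by
        rw [Nat.card_sigma]
        refine (Finset.sum_le_card_nsmul _ _ (Δ ^ 2) fun i _ => ?_).trans (by simp)
        rw [Nat.card_prod, sq]
        exact Nat.mul_le_mul (hΔ _) (hΔ _)
      refine le_trans ?_ hle
      have hx : ∀ x : ({x : Corner π | ∀ i, x.vert ≠ (f i).vert}ᶜ : Set _),
          ∃ i, x.1.vert = (f i).vert := by
        rintro ⟨x, hx⟩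
        simpa using hx
      choose g hg using hx
      refine Nat.card_le_card_of_injective
        (fun x => ⟨g x, ⟨x.1.inn, hg x⟩, ⟨x.1.out, x.1.map_out.trans (hg x)⟩⟩) ?_
      intro x y h
      have h1 : x.1.inn = y.1.inn := congrArg (fun z => z.2.1.1) h
      have h2 : x.1.out = y.1.out := congrArg (fun z => z.2.2.1) h
      exact Subtype.ext (Corner.ext h1 h2)
    rw [← Nat.card_coe_set_eq] at h2
    change Nat.card {x : Corner π // ∀ i, x.vert ≠ (f i).vert} + _ = _ at h2
    omega
  refine le_trans ?_ (Finset.card_nsmul_le_sum _ _ _ fun f _ => key f)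
  simp [Nat.card_eq_fintype_card, Finset.card_univ]

theorem two_mul_le_of_card_rep {k : ℕ} (f : Rep π (Fin k)) : 2 * k ≤ Nat.card H := by
  have := Nat.card_le_card_of_injective _ f.elim_injective
  simp at this
  omega

/-- One more corner and one more pair contribute a factor of at most `(S - 2 * k) / (m - 1 - 2 * k)
≤ ρ`. No error term depends on `k`, so the bound can dominate series over all `k`. -/
theorem card_rep_mul_pairProb_le {ρ : ℝ} (hρ0 : 0 ≤ ρ) (hρ1 : ρ ≤ 1)
    (hS : (Nat.card (Corner π) : ℝ) ≤ ρ * ((Nat.card H : ℝ) - 1)) (k : ℕ) :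
    (Nat.card (Rep π (Fin k)) : ℝ) * pairProb (Nat.card H) k ≤ ρ ^ k := by
  induction k with
  | zero => simp [card_rep_zero, pairProb]
  | succ k ih =>
    -- Without families of `k + 1` corners the left side is 0; otherwise `2 * (k + 1) ≤ m`, and the
    -- denominators are positive.
    rcases isEmpty_or_nonempty (Rep π (Fin (k + 1))) with h | ⟨⟨f⟩⟩
    · simp; positivity
    have h1 := two_mul_le_of_card_rep f
    have h1' : ((2 * (k + 1) : ℕ) : ℝ) ≤ Nat.card H := by exact_mod_cast h1
    push_cast at h1'
    have hpos : 0 < (Nat.card H : ℝ) - (2 * k + 1) := by linarith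
    have h2 : (Nat.card (Rep π (Fin (k + 1))) : ℝ) ≤
        Nat.card (Rep π (Fin k)) * (ρ * ((Nat.card H : ℝ) - (2 * k + 1))) := by
      refine (Nat.cast_le.2 (card_rep_succ_le k)).trans ?_
      rw [Nat.cast_mul]
      refine mul_le_mul_of_nonneg_left ?_ (Nat.cast_nonneg _)
      rcases le_total (Nat.card (Corner π)) (2 * k) with h3 | h3
      · rw [Nat.sub_eq_zero_of_le h3]
        simp only [Nat.cast_zero]
        positivity
      · rw [Nat.cast_sub h3]
        push_cast
        have : (0 : ℝ) ≤ (1 - ρ) * k := mul_nonneg (by linarith) (Nat.cast_nonneg _)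
        nlinarith
    have hpp : 0 ≤ pairProb (Nat.card H) k := by
      refine Finset.prod_nonneg fun i hi => inv_nonneg.2 ?_
      have h2 := Finset.mem_range.1 hi
      have : ((2 * i + 1 : ℕ) : ℝ) ≤ Nat.card H := by exact_mod_cast (by omega)
      push_cast at this
      linarith
    calc (Nat.card (Rep π (Fin (k + 1))) : ℝ) * pairProb (Nat.card H) (k + 1)
        = Nat.card (Rep π (Fin (k + 1))) *
          (pairProb (Nat.card H) k * ((Nat.card H : ℝ) - (2 * k + 1))⁻¹) := by
          rw [pairProb, Finset.prod_range_succ, ← pairProb]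
      _ ≤ Nat.card (Rep π (Fin k)) * (ρ * ((Nat.card H : ℝ) - (2 * k + 1))) *
          (pairProb (Nat.card H) k * ((Nat.card H : ℝ) - (2 * k + 1))⁻¹) := by
          gcongr
      _ = Nat.card (Rep π (Fin k)) * pairProb (Nat.card H) k * ρ := by
          field_simp
      _ ≤ ρ ^ k * ρ := by gcongr
      _ = ρ ^ (k + 1) := by ring

end Corner

/-! ### Cyclic rotations -/

theorem finRotate_pow_val {n : ℕ} (k : ℕ) (i : Fin n) :
    ((finRotate n ^ k) i : ℕ) = (i + k) % n := by
  induction k with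
  | zero => simp [Nat.mod_eq_of_lt i.2]
  | succ k ih =>
    have := i.neZero
    rw [pow_succ', Equiv.Perm.mul_apply, finRotate_apply, Fin.val_add, ih]
    rcases Nat.lt_or_ge 1 n with h | h
    · rw [Fin.val_one', Nat.mod_eq_of_lt h, Nat.mod_add_mod, add_assoc]
    · have hn : n = 1 := le_antisymm h (Nat.one_le_iff_ne_zero.2 (NeZero.ne n))
      subst hn
      simp [Nat.mod_one]

theorem exists_finRotate_pow {n : ℕ} (i j : Fin n) : ∃ k < n, (finRotate n ^ k) i = j := by
  have hi := i.2
  have hj := j.2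
  refine ⟨(j + (n - i)) % n, Nat.mod_lt _ (by omega), Fin.ext ?_⟩
  rw [finRotate_pow_val, Nat.add_mod_mod, show (i : ℕ) + (j + (n - i)) = j + n by omega,
    Nat.add_mod_right, Nat.mod_eq_of_lt hj]

theorem finRotate_pow_inj {n : ℕ} (i : Fin n) {k l : ℕ} (hk : k < n) (hl : l < n)
    (h : (finRotate n ^ k) i = (finRotate n ^ l) i) : k = l := by
  have h1 := congrArg Fin.val h
  rw [finRotate_pow_val, finRotate_pow_val] at h1
  have h2 : k ≡ l [MOD n] := Nat.ModEq.add_left_cancel' (i : ℕ) h1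
  rw [Nat.ModEq, Nat.mod_eq_of_lt hk, Nat.mod_eq_of_lt hl] at h2
  exact h2

section Cycles
variable {H V : Type*} {π : H → V} {I I' : Type*} {M : Set (Sym2 H)}

/-! ### Edges of families of corners -/

/-- The edges joining each corner to its successor. -/
def Rep.edge (f : Rep π I) (σ : Equiv.Perm I) (i : I) : Sym2 H := s((f i).out, (f (σ i)).inn)

/-- The set of edges joining a corner to its successor. -/
def Rep.edges (f : Rep π I) (σ : Equiv.Perm I) : Set (Sym2 H) := Set.range (f.edge σ)

/-- The edges of the family belong to `M`. -/
def Rep.InM (f : Rep π I) (σ : Equiv.Perm I) (M : Set (Sym2 H)) : Prop := ∀ i, f.edge σ i ∈ M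

theorem Rep.edge_injective (f : Rep π I) (σ : Equiv.Perm I) : Function.Injective (f.edge σ) := by
  intro i j h
  rcases Sym2.eq_iff.1 h with h | h
  · exact f.out_injective h.1
  · exact (f.inn_ne_out _ _ h.1.symm).elim

theorem Rep.inM_iff (f : Rep π I) (σ : Equiv.Perm I) : f.InM σ M ↔ f.edges σ ⊆ M :=
  Set.range_subset_iff.symm

/-- A half-edge belongs to one of the corners. -/
def Rep.Covers (f : Rep π I) (h : H) : Prop := ∃ i, h = (f i).out ∨ h = (f i).inn

theorem Rep.covers_iff (f : Rep π I) (σ : Equiv.Perm I) (h : H) :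
    f.Covers h ↔ ∃ e ∈ f.edges σ, h ∈ e := by
  constructor
  · rintro ⟨i, rfl | rfl⟩
    · exact ⟨_, ⟨i, rfl⟩, Sym2.mem_mk_left _ _⟩
    · refine ⟨_, ⟨σ.symm i, rfl⟩, ?_⟩
      simp [Rep.edge]
  · rintro ⟨_, ⟨i, rfl⟩, h⟩
    rcases Sym2.mem_iff.1 h with rfl | rfl
    · exact ⟨i, Or.inl rfl⟩
    · exact ⟨σ i, Or.inr rfl⟩

theorem Rep.Covers.exists_vert {f : Rep π I} {h : H} (hf : f.Covers h) :
    ∃ i, π h = (f i).vert := by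
  obtain ⟨i, rfl | rfl⟩ := hf
  · exact ⟨i, Corner.map_out _⟩
  · exact ⟨i, Corner.map_inn _⟩

theorem Rep.Covers.eq_or {f : Rep π I} {h : H} (hf : f.Covers h) {i : I}
    (hi : π h = (f i).vert) : h = (f i).out ∨ h = (f i).inn := by
  obtain ⟨j, rfl | rfl⟩ := hf
  · have : j = i := f.2 (by simpa [Corner.map_out] using hi)
    subst this; simp
  · have : j = i := f.2 (by simpa [Corner.map_inn] using hi)
    subst this; simp

theorem Rep.InM.covers_partner {f : Rep π I} {σ : Equiv.Perm I} (hM : IsPerfectMatching M)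
    (hf : f.InM σ M) {a b : H} (h : s(a, b) ∈ M) (ha : f.Covers a) : f.Covers b := by
  obtain ⟨i, rfl | rfl⟩ := ha
  · exact ⟨σ i, Or.inr (hM.eq_right h (hf i))⟩
  · have := hf (σ.symm i)
    simp only [Rep.edge, Equiv.apply_symm_apply] at this
    exact ⟨σ.symm i, Or.inl (hM.eq_right h (Sym2.eq_swap ▸ this))⟩

/-- Reversal of all the corners. -/
def Rep.swap (f : Rep π I) : Rep π I := ⟨fun i => (f i).swap, by simpa using f.2⟩

@[simp] theorem Rep.swap_apply (f : Rep π I) (i : I) : f.swap i = (f i).swap := rfl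

theorem Rep.edge_swap (f : Rep π I) (σ : Equiv.Perm I) (i : I) :
    f.swap.edge σ⁻¹ i = f.edge σ (σ⁻¹ i) := by
  simp [Rep.edge, Sym2.eq_swap]

theorem Rep.covers_swap (f : Rep π I) (h : H) : f.swap.Covers h ↔ f.Covers h := by
  simp [Rep.Covers, or_comm]

theorem Rep.InM.swap {f : Rep π I} {σ : Equiv.Perm I} (hf : f.InM σ M) : f.swap.InM σ⁻¹ M := by
  intro i
  rw [Rep.edge_swap]
  exact hf _

/-- Reindexing of a family of corners. -/
def Rep.reindex (f : Rep π I) (τ : I' ≃ I) : Rep π I' :=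
  ⟨fun i => f (τ i), f.2.comp τ.injective⟩

@[simp] theorem Rep.reindex_apply (f : Rep π I) (τ : I' ≃ I) (i : I') :
    f.reindex τ i = f (τ i) := rfl

theorem Rep.edges_reindex (f : Rep π I) (τ : I' ≃ I) (σ : Equiv.Perm I) (σ' : Equiv.Perm I')
    (h : ∀ i, τ (σ' i) = σ (τ i)) : (f.reindex τ).edges σ' = f.edges σ := by
  have : (f.reindex τ).edge σ' = f.edge σ ∘ τ := by
    funext i
    simp [Rep.edge, h]
  rw [Rep.edges, this, EquivLike.range_comp, Rep.edges]

theorem Rep.edges_swap (f : Rep π I) (σ : Equiv.Perm I) : f.swap.edges σ⁻¹ = f.edges σ := by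
  have : f.swap.edge σ⁻¹ = f.edge σ ∘ ⇑(σ⁻¹) := by
    funext i
    exact f.edge_swap σ i
  rw [Rep.edges, this, EquivLike.range_comp, Rep.edges]

/-- Two families that share a half-edge coincide from then on, if the second one does not leave
the first one. -/
theorem Rep.InM.out_pow_eq {f : Rep π I} {σ : Equiv.Perm I} {f' : Rep π I'} {σ' : Equiv.Perm I'}
    (hM : IsPerfectMatching M) (hf : f.InM σ M) (hf' : f'.InM σ' M)
    (hc : ∀ i' i, (f' i').vert = (f i).vert → f.Covers (f' i').out) {i₀' : I'} {i₀ : I}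
    (h0 : (f' i₀').out = (f i₀).out) (k : ℕ) :
    (f' ((σ' ^ k) i₀')).out = (f ((σ ^ k) i₀)).out ∧
      (f' ((σ' ^ (k + 1)) i₀')).inn = (f ((σ ^ (k + 1)) i₀)).inn := by
  have step : ∀ k, (f' ((σ' ^ k) i₀')).out = (f ((σ ^ k) i₀)).out →
      (f' ((σ' ^ (k + 1)) i₀')).inn = (f ((σ ^ (k + 1)) i₀)).inn := by
    intro k hk
    have h1 := hf' ((σ' ^ k) i₀')
    have h2 := hf ((σ ^ k) i₀)
    rw [Rep.edge, ← Equiv.Perm.mul_apply, ← pow_succ'] at h1 h2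
    rw [hk] at h1
    exact hM.eq_right h1 h2
  suffices h : (f' ((σ' ^ k) i₀')).out = (f ((σ ^ k) i₀)).out from ⟨h, step k h⟩
  induction k with
  | zero => simpa using h0
  | succ k ih =>
    have h1 := step k ih
    have hv : (f' ((σ' ^ (k + 1)) i₀')).vert = (f ((σ ^ (k + 1)) i₀)).vert := congrArg π h1
    -- At a common vertex `f'` can only leave through one of the two half-edges of the corner of
    -- `f`, and it has just arrived through the other one.
    rcases (hc _ _ hv).eq_or ((Corner.map_out _).trans hv) with h | h
    · exact h
    · exact ((f' _).inn_ne_out (h1.trans h.symm)).elim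

/-! ### Cycles -/

variable (π) in
/-- The edge sets of the cycles of length `l` that are contained in `M`. -/
def cycles (M : Set (Sym2 H)) (l : ℕ) : Set (Set (Sym2 H)) :=
  {C | ∃ f : Rep π (Fin l), f.InM (finRotate l) M ∧ f.edges (finRotate l) = C}

/-- Once the cycle is known, a cyclic family is determined by the half-edge through which it leaves
its corner 0, and each of the `2 * l` half-edges of the cycle can be that one. Working with
half-edges makes this hold for loops and double edges too. -/
theorem card_rep_edges_eq [Finite H] (hM : IsPerfectMatching M) {l : ℕ} (hl : 1 ≤ l)
    {C : Set (Sym2 H)} (hC : C ∈ cycles π M l) :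
    Nat.card {f : Rep π (Fin l) // f.InM (finRotate l) M ∧ f.edges (finRotate l) = C} = 2 * l := by
  obtain ⟨f, hf, rfl⟩ := hC
  obtain ⟨n, rfl⟩ : ∃ n, l = n + 1 := ⟨l - 1, by omega⟩
  have hT : Nat.card (Set.range (Sum.elim (fun i => (f i).out) fun i => (f i).inn)) =
      2 * (n + 1) := by
    rw [Nat.card_range_of_injective f.elim_injective, Nat.card_sum, Nat.card_fin]
    ring
  have hmem : ∀ h, h ∈ Set.range (Sum.elim (fun i => (f i).out) fun i => (f i).inn) ↔
      f.Covers h := by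
    intro h
    simp [Rep.Covers, eq_comm, exists_or]
  rw [← hT]
  refine Nat.card_congr (Equiv.ofBijective (fun g => ⟨(g.1 0).out, ?_⟩) ⟨?_, ?_⟩)
  · rw [hmem, f.covers_iff (finRotate _)]
    have := (g.1.covers_iff (finRotate _) (g.1 0).out).1 ⟨0, Or.inl rfl⟩
    simpa only [g.2.2] using this
  · rintro ⟨g, hg, hge⟩ ⟨g', hg', hge'⟩ h
    have h0 : (g 0).out = (g' 0).out := congrArg Subtype.val h
    have hc : ∀ i' i, (g i').vert = (g' i).vert → g'.Covers (g i').out := by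
      intro i' i _
      rw [g'.covers_iff (finRotate _), hge', ← hge, ← Rep.covers_iff]
      exact ⟨i', Or.inl rfl⟩
    have key := Rep.InM.out_pow_eq hM hg' hg hc h0
    refine Subtype.ext (Subtype.ext (funext fun i => Corner.ext ?_ ?_))
    · obtain ⟨k, -, hk⟩ := exists_finRotate_pow ((finRotate _) 0) i
      have := (key k).2
      rw [pow_succ, Equiv.Perm.mul_apply, hk] at this
      exact this
    · obtain ⟨k, -, hk⟩ := exists_finRotate_pow 0 i
      have := (key k).1
      rw [hk] at this
      exact this
  · rintro ⟨h, hh⟩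
    obtain ⟨i, hi⟩ := (hmem h).1 hh
    rcases hi with rfl | rfl
    · have he : (f.reindex (Equiv.addRight i)).edges (finRotate (n + 1)) =
          f.edges (finRotate (n + 1)) := by
        apply Rep.edges_reindex
        intro j
        simp only [finRotate_apply, Equiv.coe_addRight]
        exact add_right_comm _ _ _
      refine ⟨⟨f.reindex (Equiv.addRight i), ?_, he⟩, ?_⟩
      · rw [Rep.inM_iff, he, ← Rep.inM_iff]
        exact hf
      · simp
    -- An incoming half-edge becomes outgoing when all corners are reversed; the indices are then
    -- run through backwards from `i`.
    · have he : (f.swap.reindex ((Equiv.neg _).trans (Equiv.addRight i))).edges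
          (finRotate (n + 1)) = f.edges (finRotate (n + 1)) := by
        rw [← f.edges_swap]
        apply Rep.edges_reindex
        intro j
        rw [Equiv.Perm.eq_inv_iff_eq]
        simp only [finRotate_apply, Equiv.trans_apply, Equiv.neg_apply, Equiv.coe_addRight]
        abel
      refine ⟨⟨f.swap.reindex ((Equiv.neg _).trans (Equiv.addRight i)), ?_, he⟩, ?_⟩
      · rw [Rep.inM_iff, he, ← Rep.inM_iff]
        exact hf
      · simp

/-- Two sets of edges have a vertex in common. -/
def Meets (π : H → V) (C C' : Set (Sym2 H)) : Prop :=
  ∃ e ∈ C, ∃ e' ∈ C', ∃ h ∈ e, ∃ h' ∈ e', π h = π h'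

theorem Rep.exists_mem_edges_iff (f : Rep π I) (σ : Equiv.Perm I) (v : V) :
    (∃ e ∈ f.edges σ, ∃ h ∈ e, π h = v) ↔ ∃ i, (f i).vert = v := by
  constructor
  · rintro ⟨e, he, h, hh, rfl⟩
    obtain ⟨i, hi⟩ := ((f.covers_iff σ h).2 ⟨e, he, hh⟩).exists_vert
    exact ⟨i, hi.symm⟩
  · rintro ⟨i, rfl⟩
    exact ⟨_, ⟨i, rfl⟩, _, Sym2.mem_mk_left _ _, Corner.map_out _⟩

theorem Rep.meets_iff (f : Rep π I) (σ : Equiv.Perm I) (f' : Rep π I') (σ' : Equiv.Perm I') :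
    Meets π (f.edges σ) (f'.edges σ') ↔ ∃ i i', (f i).vert = (f' i').vert := by
  constructor
  · rintro ⟨e, he, e', he', h, hh, h', hh', hv⟩
    obtain ⟨i, hi⟩ := (f.exists_mem_edges_iff σ _).1 ⟨e, he, h, hh, rfl⟩
    obtain ⟨i', hi'⟩ := (f'.exists_mem_edges_iff σ' _).1 ⟨e', he', h', hh', rfl⟩
    exact ⟨i, i', by rw [hi, hi', hv]⟩
  · rintro ⟨i, i', h⟩
    exact ⟨_, ⟨i, rfl⟩, _, ⟨i', rfl⟩, _, Sym2.mem_mk_left _ _, _, Sym2.mem_mk_left _ _,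
      (Corner.map_out _).trans (h.trans (Corner.map_out _).symm)⟩

/-! ### Ears -/

/-- The half-edges `u k` and `w k` are the ends of the `k`-th edge of a path of `s + 1` edges that
starts and ends at vertices of the family `f` and is disjoint from its edges. -/
structure IsPreEar (f : Rep π I) (s : ℕ) (u w : Fin (s + 1) → H) : Prop where
  start : ∃ i, π (u 0) = (f i).vert
  finish : ∃ i, π (w (Fin.last s)) = (f i).vert
  corner : ∀ i : Fin s, π (w i.castSucc) = π (u i.succ) ∧ w i.castSucc ≠ u i.succ
  inj : Function.Injective (Sum.elim (Sum.elim (fun i => (f i).out) u)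
    (Sum.elim (fun i => (f i).inn) w))

/-- A path of edges of `M` that starts and ends at vertices of the family `f` and does not
use edges of `f`. -/
structure IsEar (f : Rep π I) (M : Set (Sym2 H)) (s : ℕ) (u w : Fin (s + 1) → H) : Prop extends
    IsPreEar f s u w where
  mem : ∀ i, s(u i, w i) ∈ M

/-- From the common half-edge on, the two families agree step by step, so `f'` runs through the
whole `σ`-cycle of `i₀`. -/
theorem Rep.InM.edges_eq_of_out_eq [Finite I] {f : Rep π I} {σ : Equiv.Perm I} {l : ℕ}
    {f' : Rep π (Fin l)}
    (hM : IsPerfectMatching M) (hf : f.InM σ M) (hf' : f'.InM (finRotate l) M)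
    (hc : ∀ i' i, (f' i').vert = (f i).vert → f.Covers (f' i').out) {i₀' : Fin l} {i₀ : I}
    (h0 : (f' i₀').out = (f i₀).out) :
    f'.edges (finRotate l) = f.edge σ '' {i | σ.SameCycle i₀ i} := by
  have key := Rep.InM.out_pow_eq hM hf hf' hc h0
  have hedge : ∀ k, f'.edge (finRotate l) ((finRotate l ^ k) i₀') = f.edge σ ((σ ^ k) i₀) := by
    intro k
    have := key k
    rw [Rep.edge, Rep.edge, ← Equiv.Perm.mul_apply, ← Equiv.Perm.mul_apply, ← pow_succ',
      ← pow_succ', this.1, this.2]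
  ext e
  constructor
  · rintro ⟨i, rfl⟩
    obtain ⟨k, -, rfl⟩ := exists_finRotate_pow i₀' i
    exact ⟨(σ ^ k) i₀, ⟨k, by simp⟩, (hedge k).symm⟩
  · rintro ⟨i, hi, rfl⟩
    obtain ⟨k, rfl⟩ := hi.exists_nat_pow_eq
    exact ⟨_, hedge k⟩

/-- A cycle that meets a family of corners is one of the cycles of the family, or else there is an
ear. -/
theorem Rep.InM.edges_eq_or_exists_ear [Finite I] {f : Rep π I} {σ : Equiv.Perm I} {l : ℕ}
    {f' : Rep π (Fin l)}
    (hM : IsPerfectMatching M) (hf : f.InM σ M) (hf' : f'.InM (finRotate l) M) {i₀ : I}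
    {i₀' : Fin l} (h0 : (f' i₀').vert = (f i₀).vert) :
    f'.edges (finRotate l) = f.edge σ '' {i | σ.SameCycle i₀ i} ∨
      ∃ s < l, ∃ u w, IsEar f M s u w := by
  -- If `f'` never departs from `f` at a common vertex, it follows a cycle of `f`, in one direction
  -- or the other. Otherwise it departs at some index `j`, and the ear is the stretch of `f'` from
  -- there to its first return to a vertex of `f`.
  by_cases hc : ∀ i' i, (f' i').vert = (f i).vert → f.Covers (f' i').out
  · left
    rcases (hc _ _ h0).eq_or ((Corner.map_out _).trans h0) with h | h
    · exact hf.edges_eq_of_out_eq hM hf' hc h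
    · rw [Rep.InM.edges_eq_of_out_eq hM hf.swap hf' (i₀' := i₀') (i₀ := i₀) ?_ (by simpa using h)]
      · ext e
        simp only [Set.mem_image, Set.mem_ofPred_eq, Rep.edge_swap, Equiv.Perm.sameCycle_inv]
        constructor
        · rintro ⟨i, hi, rfl⟩
          exact ⟨σ⁻¹ i, by simpa using hi, rfl⟩
        · rintro ⟨i, hi, rfl⟩
          exact ⟨σ i, by simpa using hi, by simp⟩
      · intro i' i hi
        rw [Rep.covers_swap]
        exact hc i' i (by simpa using hi)
  · right
    push Not at hc
    obtain ⟨j, i, hji, hj⟩ := hc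
    classical
    -- A return time exists, since `f'` is back at its starting point after `l` steps.
    have hex : ∃ t, 0 < t ∧ ∃ i, (f' ((finRotate l ^ t) j)).vert = (f i).vert := by
      refine ⟨l, j.pos, i, ?_⟩
      rw [show (finRotate l ^ l) j = j from Fin.ext (by
        rw [finRotate_pow_val, Nat.add_mod_right, Nat.mod_eq_of_lt j.2])]
      exact hji
    have hmin := fun t (ht : t < Nat.find hex) => Nat.find_min hex ht
    have hle : Nat.find hex ≤ l := by
      refine Nat.find_min' hex ⟨j.pos, i, ?_⟩
      rw [show (finRotate l ^ l) j = j from Fin.ext (by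
        rw [finRotate_pow_val, Nat.add_mod_right, Nat.mod_eq_of_lt j.2])]
      exact hji
    obtain ⟨hpos, i₁, hi₁⟩ := Nat.find_spec hex
    obtain ⟨s, hs⟩ : ∃ s, Nat.find hex = s + 1 := ⟨Nat.find hex - 1, by omega⟩
    rw [hs] at hmin hle hi₁
    have hint : ∀ t, 0 < t → t < s + 1 → ∀ i, (f' ((finRotate l ^ t) j)).vert ≠ (f i).vert :=
      fun t ht ht' i hi => hmin t ht' ⟨ht, i, hi⟩
    have hmem : ∀ k : ℕ, s((f' ((finRotate l ^ k) j)).out,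
        (f' ((finRotate l ^ (k + 1)) j)).inn) ∈ M := by
      intro k
      have := hf' ((finRotate l ^ k) j)
      rwa [Rep.edge, ← Equiv.Perm.mul_apply, ← pow_succ'] at this
    -- The ear avoids the half-edges of `f`: at time 0 by the choice of `j`, later because no vertex
    -- of `f` is visited. Its arriving half-edges then avoid them as well, `f` being closed under
    -- partners.
    have hout : ∀ k < s + 1, ¬ f.Covers (f' ((finRotate l ^ k) j)).out := by
      intro k hk hcov
      rcases Nat.eq_zero_or_pos k with rfl | h
      · exact hj hcov
      · obtain ⟨i, hi⟩ := hcov.exists_vert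
        exact hint k h hk i ((Corner.map_out _).symm.trans hi)
    have hinn : ∀ k < s + 1, ¬ f.Covers (f' ((finRotate l ^ (k + 1)) j)).inn := by
      intro k hk hcov
      exact hout k hk (hf.covers_partner hM (Sym2.eq_swap ▸ hmem k) hcov)
    refine ⟨s, by omega, fun k => (f' ((finRotate l ^ (k : ℕ)) j)).out,
      fun k => (f' ((finRotate l ^ (k + 1 : ℕ)) j)).inn, ⟨⟨i, ?_⟩, ⟨i₁, ?_⟩, ?_, ?_⟩, ?_⟩
    · simpa [Corner.map_out] using hji
    · simpa [Corner.map_inn] using hi₁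
    · intro k
      simp only [Fin.val_castSucc, Fin.val_succ]
      exact ⟨(Corner.map_out _).symm, Corner.inn_ne_out _⟩
    · refine Function.Injective.sumElim ?_ ?_ ?_
      · refine Function.Injective.sumElim f.out_injective ?_ ?_
        · intro a b hab
          exact Fin.ext (finRotate_pow_inj j (by omega) (by omega) (f'.out_injective hab))
        · intro a b hab
          exact hout b b.2 ⟨a, Or.inl hab.symm⟩
      · refine Function.Injective.sumElim f.inn_injective ?_ ?_
        · intro a b hab
          have := f'.inn_injective hab
          simp only [pow_succ', Equiv.Perm.mul_apply, EmbeddingLike.apply_eq_iff_eq] at this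
          exact Fin.ext (finRotate_pow_inj j (by omega) (by omega) this)
        · intro a b hab
          exact hinn b b.2 ⟨a, Or.inr hab.symm⟩
      · rintro (a | a) (b | b) hab
        · exact f.inn_ne_out _ _ hab.symm
        · exact hinn b b.2 ⟨a, Or.inl hab.symm⟩
        · exact hout a a.2 ⟨b, Or.inr hab⟩
        · exact f'.inn_ne_out _ _ hab.symm
    · exact fun k => hmem k

end Cycles

/-! ### Cycles in the multigraph of a configuration -/

/-- Orient the edges along the cycle; the corner at a vertex consists of the half-edge that arrives
there and the one that leaves. -/
theorem isCycleEdgeSet_iff {n : ℕ} {d : Fin n → ℕ} {M : Set (Sym2 (HalfEdge d))}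
    (hM : IsPerfectMatching M) (l : ℕ) (C : Set (Sym2 (HalfEdge d))) :
    IsCycleEdgeSet (multigraph M) l C ↔ C ∈ cycles Sigma.fst M l := by
  constructor
  · rintro ⟨v, e, hv, he, rfl, hl⟩
    have hpq : ∀ i, ∃ p q : HalfEdge d, e i = s(p, q) ∧ p.1 = v i ∧ q.1 = v (finRotate l i) := by
      intro i
      have h1 := (hl i).2
      induction hei : e i with
      | _ a b =>
        rw [hei] at h1
        rcases Sym2.eq_iff.1 h1 with h | h
        · exact ⟨a, b, rfl, h.1, h.2⟩
        · exact ⟨b, a, Sym2.eq_swap, h.2, h.1⟩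
    choose p q hpq hp hq using hpq
    have hmem : ∀ i, s(p i, q i) ∈ M := fun i => hpq i ▸ (hl i).1
    -- If the arriving and the leaving half-edge were the same, the two consecutive edges would
    -- coincide; injectivity of `e` then makes this a single edge pairing a half-edge with itself.
    have hne : ∀ i, q ((finRotate l).symm i) ≠ p i := by
      intro i h
      have h1 := hmem ((finRotate l).symm i)
      rw [h, Sym2.eq_swap] at h1
      have h2 := hM.eq_right h1 (hmem i)
      have h3 : e ((finRotate l).symm i) = e i := by
        rw [hpq, hpq, h, h2, Sym2.eq_swap]
      have h4 := he h3
      rw [h4] at h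
      exact hM.ne (hmem i) h.symm
    let f : Rep (Sigma.fst : HalfEdge d → Fin n) (Fin l) :=
      ⟨fun i => Corner.mk (q ((finRotate l).symm i)) (p i) (by rw [hq, hp, Equiv.apply_symm_apply]) (hne i), by
        intro i j hij
        have : (q ((finRotate l).symm i)).1 = (q ((finRotate l).symm j)).1 := hij
        rw [hq, hq, Equiv.apply_symm_apply, Equiv.apply_symm_apply] at this
        exact hv this⟩
    have hfe : f.edge (finRotate l) = e := by
      funext i
      rw [hpq]
      simp only [Rep.edge, f, Corner.out_mk, Corner.inn_mk, Equiv.symm_apply_apply]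
    refine ⟨f, fun i => ?_, ?_⟩
    · rw [hfe, hpq]
      exact hmem i
    · rw [Rep.edges, hfe]
  · rintro ⟨f, hf, rfl⟩
    refine ⟨fun i => (f i).vert, f.edge (finRotate l), f.2, f.edge_injective _, rfl, fun i => ?_⟩
    refine ⟨hf i, ?_⟩
    rw [Rep.edge, Sym2.map_mk]
    exact congrArg₂ (fun a b => s(a, b)) (Corner.map_out _) (Corner.map_inn _)

theorem numCycles_multigraph {n : ℕ} {d : Fin n → ℕ} {M : Set (Sym2 (HalfEdge d))}
    (hM : IsPerfectMatching M) (l : ℕ) :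
    numCycles (multigraph M) l = (cycles Sigma.fst M l).ncard := by
  rw [numCycles]
  congr 1
  ext C
  exact isCycleEdgeSet_iff hM l C

/-- Choose the `c` different images first, then lift each of them in `k` ways. Applied to cycles and
their `2 * l` cyclic orderings, this produces the falling factorials. -/
theorem card_injective_comp {α β : Type*} [Finite α] [Finite β] (F : α → β) (k : ℕ)
    (h : ∀ b, Nat.card {a // F a = b} = k) (c : ℕ) :
    Nat.card {g : Fin c → α // Function.Injective fun i => F (g i)} =
      k ^ c * (Nat.card β).descFactorial c := by
  classical
  have := Fintype.ofFinite β
  have h1 : Nat.card (Fin c ↪ β) = (Nat.card β).descFactorial c := by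
    rw [Nat.card_eq_fintype_card, Fintype.card_embedding_eq, Nat.card_eq_fintype_card,
      Fintype.card_fin]
  let G : {g : Fin c → α // Function.Injective fun i => F (g i)} → (Fin c ↪ β) :=
    fun g => ⟨fun i => F (g.1 i), g.2⟩
  rw [card_eq_card_mul_of_fiber G (k ^ c), h1, mul_comm]
  intro e
  have h2 : {g // G g = e} ≃ ((i : Fin c) → {a // F a = e i}) :=
    { toFun := fun g i => ⟨g.1.1 i, DFunLike.congr_fun g.2 i⟩
      invFun := fun g => ⟨⟨fun i => (g i).1, by simpa [(g _).2] using e.injective⟩,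
        DFunLike.ext _ _ fun i => (g i).2⟩
      left_inv := fun _ => rfl
      right_inv := fun _ => rfl }
  rw [Nat.card_congr h2, Nat.card_pi, Finset.prod_congr rfl fun i _ => h (e i)]
  simp

/-! ### Isolated cycles -/

section Isolated
variable {H V : Type*} {π : H → V} {I : Type*}

variable (π) in
/-- A set of edges is isolated if it meets no other cycle with a length in `A`. -/
def IsIsolated (A : Finset ℕ) (M : Set (Sym2 H)) (C : Set (Sym2 H)) : Prop :=
  ∀ l ∈ A, ∀ C' ∈ cycles π M l, Meets π C C' → C' = C

variable (π) in
/-- The number of isolated cycles of length `l`. -/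
def isoCount (A : Finset ℕ) (M : Set (Sym2 H)) (l : ℕ) : ℕ :=
  Nat.card {C // C ∈ cycles π M l ∧ IsIsolated π A M C}

/-- The hypothesis `hC` says that `C` is the cycle of the family at each of its vertices. A
different cycle that meets `C` is therefore not the cycle of the family at the meeting point and
must have an ear. -/
theorem Rep.InM.exists_ear_of_not_isIsolated [Finite I] {A : Finset ℕ} {L : ℕ}
    (hL : ∀ l ∈ A, l ≤ L) {M : Set (Sym2 H)} (hM : IsPerfectMatching M) {f : Rep π I}
    {σ : Equiv.Perm I} (hf : f.InM σ M) {C : Set (Sym2 H)} (hCM : C ⊆ f.edges σ)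
    (hC : ∀ i₀, (∃ e ∈ C, ∃ h ∈ e, π h = (f i₀).vert) →
      C = f.edge σ '' {i | σ.SameCycle i₀ i}) (h : ¬ IsIsolated π A M C) :
    ∃ s < L, ∃ u w, IsEar f M s u w := by
  simp only [IsIsolated, not_forall] at h
  obtain ⟨l, hl, C', ⟨f', hf', rfl⟩, ⟨e, he, e', he', a, ha, a', ha', haa'⟩, hne⟩ := h
  obtain ⟨i₀', hi'⟩ := (f'.exists_mem_edges_iff _ _).1 ⟨e', he', a', ha', rfl⟩
  obtain ⟨i₀, hi⟩ := (f.exists_mem_edges_iff σ _).1 ⟨e, hCM he, a, ha, rfl⟩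
  rcases hf.edges_eq_or_exists_ear hM hf' (i₀ := i₀) (i₀' := i₀') (by rw [hi, hi', haa']) with
    h1 | ⟨s, hs, h1⟩
  · rw [hC i₀ ⟨e, he, a, ha, hi.symm⟩] at hne
    exact (hne h1).elim
  · exact ⟨s, hs.trans_le (hL l hl), h1⟩

theorem sameCycle_finRotate {n : ℕ} (i j : Fin n) : (finRotate n).SameCycle i j := by
  obtain ⟨k, -, hk⟩ := exists_finRotate_pow i j
  exact ⟨k, by simpa using hk⟩

/-! ### Families of cycles -/

section Family
variable (A : Finset ℕ) (c : ℕ → ℕ)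

/-- The index set of the vertices of a family of cycles, `c l` of them of length `l ∈ A`. -/
abbrev FamIndex : Type := (j : (l : A) × Fin (c l)) × Fin j.1

/-- The successor on the index set of a family of cycles. -/
def famRot : Equiv.Perm (FamIndex A c) := Equiv.sigmaCongrRight fun j => finRotate j.1

theorem card_famIndex : Nat.card (FamIndex A c) = ∑ l ∈ A, l * c l := by
  rw [Nat.card_sigma, ← Finset.univ_sigma_univ, Finset.sum_sigma,
    ← Finset.sum_coe_sort A fun l => l * c l]
  simp [mul_comm]

variable {A c}

theorem famRot_pow (j : (l : A) × Fin (c l)) (i : Fin j.1) (k : ℕ) :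
    (famRot A c ^ k) ⟨j, i⟩ = ⟨j, (finRotate j.1 ^ k) i⟩ := by
  induction k with
  | zero => simp
  | succ k ih => rw [pow_succ', pow_succ', Equiv.Perm.mul_apply, ih]; rfl

theorem famRot_sameCycle_iff (j : (l : A) × Fin (c l)) (i : Fin j.1) (x : FamIndex A c) :
    (famRot A c).SameCycle ⟨j, i⟩ x ↔ x.1 = j := by
  constructor
  · intro h
    obtain ⟨k, rfl⟩ := h.exists_nat_pow_eq
    rw [famRot_pow]
  · obtain ⟨j', i'⟩ := x
    rintro rfl
    obtain ⟨k, -, hk⟩ := exists_finRotate_pow i i'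
    exact ⟨k, by rw [zpow_natCast, famRot_pow, hk]⟩

/-- One of the cycles of a family of cycles. -/
def Rep.comp (f : Rep π (FamIndex A c)) (j : (l : A) × Fin (c l)) : Rep π (Fin j.1) :=
  ⟨fun i => f ⟨j, i⟩, f.2.comp sigma_mk_injective⟩

theorem Rep.edges_comp (f : Rep π (FamIndex A c)) (j : (l : A) × Fin (c l)) (i : Fin j.1) :
    (f.comp j).edges (finRotate j.1) =
      f.edge (famRot A c) '' {x | (famRot A c).SameCycle ⟨j, i⟩ x} := by
  ext e
  simp only [famRot_sameCycle_iff]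
  constructor
  · rintro ⟨i', rfl⟩
    exact ⟨⟨j, i'⟩, rfl, rfl⟩
  · rintro ⟨⟨j', i'⟩, h, rfl⟩
    obtain rfl : j' = j := h
    exact ⟨i', rfl⟩

theorem ncard_of_mem_cycles {M : Set (Sym2 H)} {l : ℕ} {C : Set (Sym2 H)}
    (h : C ∈ cycles π M l) : C.ncard = l := by
  obtain ⟨f, -, rfl⟩ := h
  rw [← Nat.card_coe_set_eq, Rep.edges, Nat.card_range_of_injective (f.edge_injective _),
    Nat.card_fin]

/-- A family of different isolated cycles. -/
def Rep.IsGood (f : Rep π (FamIndex A c)) (M : Set (Sym2 H)) : Prop :=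
  f.InM (famRot A c) M ∧ ∀ j, IsIsolated π A M ((f.comp j).edges (finRotate j.1))

theorem Rep.InM.exists_ear_of_not_isGood {L : ℕ} (hL : ∀ l ∈ A, l ≤ L) {M : Set (Sym2 H)}
    (hM : IsPerfectMatching M) {f : Rep π (FamIndex A c)} (hf : f.InM (famRot A c) M)
    (h : ¬ f.IsGood M) : ∃ s < L, ∃ u w, IsEar f M s u w := by
  simp only [Rep.IsGood, hf, true_and, not_forall] at h
  obtain ⟨j, hj⟩ := h
  refine hf.exists_ear_of_not_isIsolated hL hM ?_ ?_ hj
  · rintro _ ⟨i, rfl⟩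
    exact ⟨⟨j, i⟩, rfl⟩
  · rintro ⟨j', i₀⟩ hi
    obtain ⟨i, hi⟩ := ((f.comp j).exists_mem_edges_iff _ _).1 hi
    have : (⟨j, i⟩ : FamIndex A c) = ⟨j', i₀⟩ := f.2 hi
    obtain rfl : j = j' := congrArg Sigma.fst this
    exact f.edges_comp j i₀

variable [Finite H]

/-- Cyclically ordered isolated cycles of length `l`. -/
abbrev IsoRep (π : H → V) (A : Finset ℕ) (M : Set (Sym2 H)) (l : ℕ) : Type _ :=
  {r : Rep π (Fin l) // r.InM (finRotate l) M ∧ IsIsolated π A M (r.edges (finRotate l))}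

/-- The edge set of a cyclically ordered isolated cycle. -/
def IsoRep.toCycle {M : Set (Sym2 H)} {l : ℕ} (r : IsoRep π A M l) :
    {C // C ∈ cycles π M l ∧ IsIsolated π A M C} :=
  ⟨r.1.edges (finRotate l), ⟨r.1, r.2.1, rfl⟩, r.2.2⟩

theorem card_toCycle_fiber {M : Set (Sym2 H)} (hM : IsPerfectMatching M) {l : ℕ} (hl : 1 ≤ l)
    (C : {C // C ∈ cycles π M l ∧ IsIsolated π A M C}) :
    Nat.card {r : IsoRep π A M l // r.toCycle = C} = 2 * l := by
  rw [← card_rep_edges_eq hM hl C.2.1]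
  refine Nat.card_congr
    { toFun := fun r => ⟨r.1.1, r.1.2.1, congrArg Subtype.val r.2⟩
      invFun := fun r => ⟨⟨r.1, r.2.1, by rw [r.2.2]; exact C.2.2⟩, Subtype.ext r.2.2⟩
      left_inv := fun _ => rfl
      right_inv := fun _ => rfl }

/-- Different isolated cycles share no vertex, so a good family amounts to an injective sequence of
`c l` isolated cycles for each `l`, each with one of its `2 * l` cyclic orderings. This turns
factorial moments into numbers of families. -/
theorem card_isGood (hA : ∀ l ∈ A, 1 ≤ l) {M : Set (Sym2 H)} (hM : IsPerfectMatching M) :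
    Nat.card {f : Rep π (FamIndex A c) // f.IsGood M} =
      ∏ l ∈ A, (2 * l) ^ c l * (isoCount π A M l).descFactorial (c l) := by
  have e : {f : Rep π (FamIndex A c) // f.IsGood M} ≃ ((l : A) →
      {g : Fin (c l) → IsoRep π A M l // Function.Injective fun i => (g i).toCycle}) := by
    refine
      { toFun := fun f l => ⟨fun k => ⟨f.1.comp ⟨l, k⟩, fun i => f.2.1 ⟨⟨l, k⟩, i⟩, f.2.2 ⟨l, k⟩⟩,
          ?_⟩
        invFun := fun g => ⟨⟨fun x => (g x.1.1).1 x.1.2 |>.1 x.2, ?_⟩, ?_, ?_⟩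
        left_inv := fun _ => rfl
        right_inv := fun _ => rfl }
    · intro k k' h
      have h1 : (f.1.comp ⟨l, k⟩).edges (finRotate l) = (f.1.comp ⟨l, k'⟩).edges (finRotate l) :=
        congrArg Subtype.val h
      have h2 : (f.1.comp ⟨l, k⟩).edge (finRotate l) ⟨0, hA l l.2⟩ ∈
          (f.1.comp ⟨l, k'⟩).edges (finRotate l) := h1 ▸ ⟨_, rfl⟩
      obtain ⟨i, hi⟩ := h2
      have h3 : (⟨⟨l, k'⟩, i⟩ : FamIndex A c) = ⟨⟨l, k⟩, ⟨0, hA l l.2⟩⟩ :=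
        f.1.edge_injective (famRot A c) hi
      have h4 := congrArg Sigma.fst h3
      simpa using h4.symm
    · rintro ⟨⟨l, k⟩, i⟩ ⟨⟨l', k'⟩, i'⟩ h
      -- By isolation, two members with a common vertex have the same edge set, hence the same
      -- length; injectivity then gives the same index, and finally the same position.
      have hm : Meets π (((g l).1 k).1.edges (finRotate l)) (((g l').1 k').1.edges (finRotate l')) :=
        (Rep.meets_iff _ _ _ _).2 ⟨i, i', h⟩
      have he := ((g l).1 k).2.2 l' l'.2 _ ⟨_, ((g l').1 k').2.1, rfl⟩ hm
      have hll : l = l' := by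
        apply Subtype.ext
        rw [← ncard_of_mem_cycles (π := π) (M := M) ⟨_, ((g l).1 k).2.1, rfl⟩, ← he]
        exact ncard_of_mem_cycles (π := π) (M := M) ⟨_, ((g l').1 k').2.1, rfl⟩
      subst hll
      have hkk : k' = k := (g l).2 (Subtype.ext he)
      subst hkk
      have := ((g l).1 k').1.2 h
      simp only at this
      subst this
      rfl
    · rintro ⟨⟨l, k⟩, i⟩
      exact ((g l).1 k).2.1 i
    · rintro ⟨l, k⟩
      exact ((g l).1 k).2.2
  rw [Nat.card_congr e, Nat.card_pi, 
    ← Finset.prod_coe_sort A fun l => (2 * l) ^ c l * (isoCount π A M l).descFactorial (c l)]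
  refine Finset.prod_congr rfl fun l _ => ?_
  rw [card_injective_comp _ (2 * l) (card_toCycle_fiber hM (hA l l.2))]
  rfl

end Family

/-! ### Counting families and ears -/

section Count
variable [Finite H] [Finite I]

/-- Families of corners together with the half-edges of a possible ear. -/
abbrev EarData (π : H → V) (I : Type*) (s : ℕ) : Type _ :=
  {x : Rep π I × (Fin (s + 1) → H) × (Fin (s + 1) → H) // IsPreEar x.1 s x.2.1 x.2.2}

/-- An ear is encoded by its two end half-edges, which lie at vertices of the family, and the
corners at its `s` inner vertices. It has one more edge than inner vertices, so in expectation it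
costs a factor of order `Δ ^ 2 / m`. -/
theorem card_earData_le {Δ : ℕ} (hΔ : ∀ v, Nat.card {h // π h = v} ≤ Δ) (s : ℕ) :
    Nat.card (EarData π I s) ≤
      Nat.card (Rep π I) * ((Nat.card I * Δ) ^ 2 * Nat.card (Corner π) ^ s) := by
  have := Fintype.ofFinite (Rep π I)
  have := Fintype.ofFinite I
  have hB : ∀ f : Rep π I, Nat.card {h // ∃ i, π h = (f i).vert} ≤ Nat.card I * Δ := by
    intro f
    have h1 : Nat.card (Σ i : I, {h // π h = (f i).vert}) ≤ Nat.card I * Δ := by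
      rw [Nat.card_sigma]
      refine (Finset.sum_le_card_nsmul _ _ Δ fun i _ => hΔ _).trans ?_
      simp [Nat.card_eq_fintype_card]
    refine le_trans ?_ h1
    refine Nat.card_le_card_of_injective
      (fun h => ⟨h.2.choose, h.1, h.2.choose_spec⟩) ?_
    intro a b h
    exact Subtype.ext (congrArg (fun x : (Σ i : I, {h // π h = (f i).vert}) => x.2.1) h)
  have h2 : Nat.card (Σ f : Rep π I, {h // ∃ i, π h = (f i).vert} ×
      {h // ∃ i, π h = (f i).vert} × (Fin s → Corner π)) ≤
      Nat.card (Rep π I) * ((Nat.card I * Δ) ^ 2 * Nat.card (Corner π) ^ s) := by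
    rw [Nat.card_sigma]
    refine (Finset.sum_le_card_nsmul _ _
      ((Nat.card I * Δ) ^ 2 * Nat.card (Corner π) ^ s) fun f _ => ?_).trans ?_
    · rw [Nat.card_prod, Nat.card_prod, Nat.card_fun, Nat.card_fin, sq, mul_assoc]
      exact Nat.mul_le_mul (hB f) (Nat.mul_le_mul_right _ (hB f))
    · simp [Nat.card_eq_fintype_card, Finset.card_univ]
  refine le_trans ?_ h2
  refine Nat.card_le_card_of_injective (fun x => ⟨x.1.1, ⟨_, x.2.start⟩, ⟨_, x.2.finish⟩,
    fun i => Corner.mk _ _ (x.2.corner i).1 (x.2.corner i).2⟩) ?_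
  rintro ⟨⟨f, u, w⟩, hx⟩ ⟨⟨f', u', w'⟩, hx'⟩ h
  obtain rfl : f = f' := congrArg Sigma.fst h
  have h := eq_of_heq (Sigma.mk.inj h).2
  simp only [Prod.mk.injEq, Subtype.mk.injEq] at h
  obtain ⟨h0, h1, h3⟩ := h
  have hu : u = u' := by
    funext k
    induction k using Fin.cases with
    | zero => exact h0
    | succ k => exact congrArg Corner.out (congrFun h3 k)
  have hw : w = w' := by
    funext k
    induction k using Fin.lastCases with
    | last => exact h1
    | cast k => exact congrArg Corner.inn (congrFun h3 k)
  subst hu hw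
  rfl

variable [Nonempty (PerfectMatching H)]

theorem avg_card_inM (σ : Equiv.Perm I) :
    avg (fun M : PerfectMatching H => (Nat.card {f : Rep π I // f.InM σ M.1} : ℝ)) =
      Nat.card (Rep π I) * pairProb (Nat.card H) (Nat.card I) := by
  refine avg_card_subtype_eq (fun (M : PerfectMatching H) (f : Rep π I) => f.InM σ M.1) _
    (fun f => ?_) inferInstance
  refine card_matching (fun i => (f i).out) (fun i => (f (σ i)).inn) ?_
  have := f.elim_injective.comp (Function.Injective.sumMap Function.injective_id σ.injective)
  rwa [Sum.elim_comp_map] at this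

/-- This is a first moment bound. The conditions of `IsPreEar` do not involve the matching, so
family and ear are counted together beforehand; their edges are `Nat.card I + (s + 1)` disjoint
pairs, to which `card_matching` applies. -/
theorem avg_card_ear_le {Δ : ℕ} (hΔ : ∀ v, Nat.card {h // π h = v} ≤ Δ) (σ : Equiv.Perm I)
    (L : ℕ) :
    avg (fun M : PerfectMatching H =>
      (Nat.card {f : Rep π I // f.InM σ M.1 ∧ ∃ s < L, ∃ u w, IsEar f M.1 s u w} : ℝ)) ≤
      ∑ s ∈ Finset.range L, (Nat.card (Rep π I) * ((Nat.card I * Δ) ^ 2 *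
        Nat.card (Corner π) ^ s)) * |pairProb (Nat.card H) (Nat.card I + (s + 1))| := by
  have key : ∀ s, avg (fun M : PerfectMatching H =>
      (Nat.card {x : EarData π I s // x.1.1.InM σ M.1 ∧
        ∀ i, s(x.1.2.1 i, x.1.2.2 i) ∈ M.1} : ℝ)) ≤ (Nat.card (Rep π I) * ((Nat.card I * Δ) ^ 2 *
        Nat.card (Corner π) ^ s)) * |pairProb (Nat.card H) (Nat.card I + (s + 1))| := by
    intro s
    refine (avg_card_subtype_le (fun (M : PerfectMatching H) (x : EarData π I s) =>
      x.1.1.InM σ M.1 ∧ ∀ i, s(x.1.2.1 i, x.1.2.2 i) ∈ M.1)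
      |pairProb (Nat.card H) (Nat.card I + (s + 1))| (fun x => ?_) inferInstance).trans ?_
    -- `pairProb` can be negative when more pairs are asked for than fit; the absolute value keeps
    -- the bound monotone in the number of ears.
    · refine le_trans ?_ (mul_le_mul_of_nonneg_left (le_abs_self _) (Nat.cast_nonneg _))
      have := card_matching (J := I ⊕ Fin (s + 1))
        (Sum.elim (fun i => (x.1.1 i).out) x.1.2.1)
        (Sum.elim (fun i => (x.1.1 (σ i)).inn) x.1.2.2) ?_
      · rw [Nat.card_sum, Nat.card_fin] at this
        rw [← this]
        simp only [Sum.forall, Sum.elim_inl, Sum.elim_inr]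
        exact le_rfl
      · have h1 := x.2.inj.comp (Function.Injective.sumMap Function.injective_id
          (Function.Injective.sumMap σ.injective Function.injective_id))
        rwa [Sum.elim_comp_map, Sum.elim_comp_map] at h1
    · refine mul_le_mul_of_nonneg_right ?_ (abs_nonneg _)
      exact_mod_cast card_earData_le hΔ s
  refine le_trans ?_ (Finset.sum_le_sum fun s _ => key s)
  rw [← avg_sum]
  refine avg_mono fun M => ?_
  rw [← Nat.cast_sum, Nat.cast_le, ← Finset.sum_coe_sort, ← Nat.card_sigma]
  have hx : ∀ f : {f : Rep π I // f.InM σ M.1 ∧ ∃ s < L, ∃ u w, IsEar f M.1 s u w},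
      ∃ (s : Finset.range L) (u : Fin (s + 1) → H) (w : Fin (s + 1) → H), IsEar f.1 M.1 s u w := by
    rintro ⟨f, hf, s, hs, u, w, h⟩
    exact ⟨⟨s, Finset.mem_range.2 hs⟩, u, w, h⟩
  choose s u w h using hx
  refine Nat.card_le_card_of_injective
    (fun f => ⟨s f, ⟨⟨f.1, u f, w f⟩, (h f).toIsPreEar⟩, f.2.1, (h f).mem⟩) ?_
  intro f f' hff
  exact Subtype.ext (congrArg (fun x : (Σ s : Finset.range L, {x : EarData π I s //
    x.1.1.InM σ M.1 ∧ ∀ i, s(x.1.2.1 i, x.1.2.2 i) ∈ M.1}) => x.2.1.1.1) hff)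

end Count

end Isolated

/-! ### Poisson limits from factorial moments -/

/-- Inclusion-exclusion: the summand is `(-1) ^ j * x.choose a * (x - a).choose j`, and the
alternating sum of binomial coefficients vanishes unless `x - a = 0`. When `x < a` the factor
`x.choose a` is 0. -/
theorem hasSum_descFactorial (a x : ℕ) :
    HasSum (fun j : ℕ => (-1 : ℝ) ^ j / (a ! * j !) * (x.descFactorial (a + j) : ℝ))
      (if x = a then 1 else 0) := by
  have hterm : ∀ j : ℕ, (-1 : ℝ) ^ j / (a ! * j !) * (x.descFactorial (a + j) : ℝ) =
      (-1) ^ j * ((x.choose a : ℝ) * ((x - a).choose j : ℝ)) := by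
    intro j
    have h1 : x.choose (a + j) * (a + j).choose a = x.choose a * (x - a).choose j := by
      rw [Nat.choose_mul (Nat.le_add_right a j), Nat.add_sub_cancel_left]
    have h2 := Nat.add_choose_mul_factorial_mul_factorial a j
    have h3 : x.descFactorial (a + j) = a ! * j ! * (x.choose a * (x - a).choose j) := by
      rw [Nat.descFactorial_eq_factorial_mul_choose, ← h1, ← h2, Nat.choose_symm_add]
      ring
    rw [h3]
    push_cast
    have ha : (a ! : ℝ) ≠ 0 := by exact_mod_cast a.factorial_ne_zero
    have hj : (j ! : ℝ) ≠ 0 := by exact_mod_cast j.factorial_ne_zero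
    field_simp
  simp_rw [hterm]
  have h0 : ∀ j ∉ Finset.range (x - a + 1),
      (-1 : ℝ) ^ j * ((x.choose a : ℝ) * ((x - a).choose j : ℝ)) = 0 := by
    intro j hj
    rw [Nat.choose_eq_zero_of_lt (n := x - a) (k := j) (by rw [Finset.mem_range] at hj; omega)]
    simp
  convert (hasSum_sum_of_ne_finset_zero (L := .unconditional ℕ) h0) using 1
  have h1 := Int.alternating_sum_range_choose (n := x - a)
  have h2 : ∑ j ∈ Finset.range (x - a + 1), (-1 : ℝ) ^ j * ((x - a).choose j : ℝ) =
      if x - a = 0 then 1 else 0 := by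
    have := congrArg (Int.cast : ℤ → ℝ) h1
    push_cast at this
    rw [this]
  simp_rw [mul_left_comm _ (x.choose a : ℝ)]
  rw [← Finset.mul_sum, h2]
  rcases lt_trichotomy x a with h | h | h
  · rw [Nat.choose_eq_zero_of_lt h]
    simp [h.ne]
  · simp [h]
  · have : x - a ≠ 0 := by omega
    simp [h.ne', this]

section Poisson
variable {Ω : ℕ → Type*} [∀ n, Fintype (Ω n)] {U : Finset ℕ} {x : ∀ n, ℕ → Ω n → ℕ}
  {lam r : ℕ → ℝ}

open scoped Classical in
-- The indicators are introduced one length at a time. That of `x n l₀ ω = a l₀` is expanded by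
-- `hasSum_descFactorial`, which raises the exponent at `l₀` from 0 to `a l₀ + j`; this is why `c`
-- has to vanish on `A`. The limit is taken termwise by dominated convergence, and the series in
-- `(-lam l₀) ^ j / j !` sums to the exponential.
theorem tendsto_avg_indicator_mul_descFactorial
    (hlim : ∀ c : ℕ → ℕ, Tendsto (fun n => avg fun ω : Ω n =>
      ∏ l ∈ U, ((x n l ω).descFactorial (c l) : ℝ)) atTop (𝓝 (∏ l ∈ U, lam l ^ c l)))
    (hbd : ∀ᶠ n in atTop, ∀ c : ℕ → ℕ, (avg fun ω : Ω n =>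
      ∏ l ∈ U, ((x n l ω).descFactorial (c l) : ℝ)) ≤ ∏ l ∈ U, r l ^ c l) (a : ℕ → ℕ)
    (A : Finset ℕ) (hA : A ⊆ U) :
    ∀ c : ℕ → ℕ, (∀ l ∈ A, c l = 0) → Tendsto (fun n => avg fun ω : Ω n =>
      (if ∀ l ∈ A, x n l ω = a l then 1 else 0) *
        ∏ l ∈ U, ((x n l ω).descFactorial (c l) : ℝ)) atTop
      (𝓝 ((∏ l ∈ A, Real.exp (-lam l) * (lam l ^ a l / (a l)!)) * ∏ l ∈ U, lam l ^ c l)) := by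
  induction A using Finset.induction_on with
  | empty => intro c _; simpa using hlim c
  | insert l₀ A hl₀ ih =>
    intro c hc
    have hl₀U : l₀ ∈ U := hA (Finset.mem_insert_self _ _)
    have ih := ih (fun l hl => hA (Finset.mem_insert_of_mem hl))
    have hc0 : c l₀ = 0 := hc l₀ (Finset.mem_insert_self _ _)
    let c' : ℕ → ℕ → ℕ := fun j => Function.update c l₀ (a l₀ + j)
    have hc' : ∀ j, ∀ l ∈ A, c' j l = 0 := by
      intro j l hl
      have : l ≠ l₀ := fun h => hl₀ (h ▸ hl)
      simp only [c', Function.update_of_ne this]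
      exact hc l (Finset.mem_insert_of_mem hl)
    have hprod : ∀ (F : ℕ → ℕ → ℝ), (∀ l, F l 0 = 1) → ∀ j, ∏ l ∈ U, F l (c' j l) =
        F l₀ (a l₀ + j) * ∏ l ∈ U, F l (c l) := by
      intro F hF j
      rw [← Finset.mul_prod_erase U _ hl₀U, ← Finset.mul_prod_erase U (fun l => F l (c l)) hl₀U,
        hc0, hF, one_mul]
      simp only [c', Function.update_self]
      congr 1
      refine Finset.prod_congr rfl fun l hl => ?_
      rw [Function.update_of_ne (Finset.ne_of_mem_erase hl)]
    let T : ℕ → ℕ → ℝ := fun n j => (-1 : ℝ) ^ j / ((a l₀)! * j !) * avg fun ω : Ω n =>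
      (if ∀ l ∈ A, x n l ω = a l then 1 else 0) *
        ∏ l ∈ U, ((x n l ω).descFactorial (c' j l) : ℝ)
    have hsum : ∀ n, HasSum (T n) (avg fun ω : Ω n =>
        (if ∀ l ∈ insert l₀ A, x n l ω = a l then 1 else 0) *
        ∏ l ∈ U, ((x n l ω).descFactorial (c l) : ℝ)) := by
      intro n
      have h1 : ∀ ω : Ω n, HasSum (fun j => (-1 : ℝ) ^ j / ((a l₀)! * j !) *
          ((if ∀ l ∈ A, x n l ω = a l then 1 else 0) *
          ∏ l ∈ U, ((x n l ω).descFactorial (c' j l) : ℝ)))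
          ((if ∀ l ∈ insert l₀ A, x n l ω = a l then 1 else 0) *
          ∏ l ∈ U, ((x n l ω).descFactorial (c l) : ℝ)) := by
        intro ω
        have h2 := (hasSum_descFactorial (a l₀) (x n l₀ ω)).mul_right
          ((if ∀ l ∈ A, x n l ω = a l then 1 else 0) *
            ∏ l ∈ U, ((x n l ω).descFactorial (c l) : ℝ))
        convert! h2 using 1
        · funext j
          rw [hprod (fun l k => ((x n l ω).descFactorial k : ℝ)) (fun l => by simp)]
          ring
        · simp only [Finset.forall_mem_insert]
          by_cases h3 : x n l₀ ω = a l₀ <;> by_cases h4 : ∀ l ∈ A, x n l ω = a l <;>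
            simp [h3, h4]
      have h2 := (hasSum_sum (s := Finset.univ) fun ω _ => h1 ω).div_const (Nat.card (Ω n) : ℝ)
      convert! h2 using 1
      funext j
      simp only [T, avg, ← Finset.mul_sum]
      ring
    have hlimval : ∑' j : ℕ, (-1 : ℝ) ^ j / ((a l₀)! * j !) *
        ((∏ l ∈ A, Real.exp (-lam l) * (lam l ^ a l / (a l)!)) * ∏ l ∈ U, lam l ^ c' j l) =
        (∏ l ∈ insert l₀ A, Real.exp (-lam l) * (lam l ^ a l / (a l)!)) *
          ∏ l ∈ U, lam l ^ c l := by
      have h1 := (NormedSpace.expSeries_div_hasSum_exp (-lam l₀)).mul_right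
        ((lam l₀ ^ a l₀ / (a l₀)!) *
        ((∏ l ∈ A, Real.exp (-lam l) * (lam l ^ a l / (a l)!)) * ∏ l ∈ U, lam l ^ c l))
      rw [← Real.exp_eq_exp_ℝ] at h1
      rw [Finset.prod_insert hl₀]
      refine HasSum.tsum_eq ?_
      convert! h1 using 1
      · funext j
        rw [hprod (fun l k => lam l ^ k) (fun l => pow_zero _), neg_pow]
        have ha : ((a l₀)! : ℝ) ≠ 0 := by exact_mod_cast (a l₀).factorial_ne_zero
        have hj : (j ! : ℝ) ≠ 0 := by exact_mod_cast j.factorial_ne_zero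
        field_simp
        ring
      · ring
    rw [← hlimval]
    have hfun : (fun n => avg fun ω : Ω n =>
        (if ∀ l ∈ insert l₀ A, x n l ω = a l then (1 : ℝ) else 0) *
        ∏ l ∈ U, ((x n l ω).descFactorial (c l) : ℝ)) = fun n => ∑' j, T n j :=
      funext fun n => (hsum n).tsum_eq.symm
    rw [hfun]
    -- The geometric bound on the factorial moments, divided by `j !`, is a summable majorant for
    -- all large `n` at once.
    refine tendsto_tsum_of_dominated_convergence (bound := fun j => (r l₀ ^ j / j !) *
      (r l₀ ^ a l₀ / (a l₀)! * ∏ l ∈ U, r l ^ c l)) ?_ ?_ ?_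
    · exact (Real.summable_pow_div_factorial _).mul_right _
    · intro j
      exact (ih (c' j) (hc' j)).const_mul _
    · filter_upwards [hbd] with n hn j
      have h1 : 0 ≤ avg fun ω : Ω n => (if ∀ l ∈ A, x n l ω = a l then (1 : ℝ) else 0) *
          ∏ l ∈ U, ((x n l ω).descFactorial (c' j l) : ℝ) := by
        refine avg_nonneg fun ω => mul_nonneg (by split_ifs <;> norm_num) ?_
        exact Finset.prod_nonneg fun _ _ => Nat.cast_nonneg _
      have h2 : (avg fun ω : Ω n => (if ∀ l ∈ A, x n l ω = a l then (1 : ℝ) else 0) *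
          ∏ l ∈ U, ((x n l ω).descFactorial (c' j l) : ℝ)) ≤ ∏ l ∈ U, r l ^ c' j l := by
        refine le_trans (avg_mono fun ω => ?_) (hn (c' j))
        refine mul_le_of_le_one_left ?_ (by split_ifs <;> norm_num)
        exact Finset.prod_nonneg fun _ _ => Nat.cast_nonneg _
      rw [hprod (fun l k => r l ^ k) (fun l => pow_zero _)] at h2
      simp only [T]
      rw [norm_mul, Real.norm_of_nonneg h1, norm_div, norm_pow, norm_neg, norm_one, one_pow,
        Real.norm_of_nonneg (by positivity)]
      refine (mul_le_mul_of_nonneg_left h2 (by positivity)).trans (le_of_eq ?_)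
      rw [pow_add]
      field_simp

open scoped Classical in
theorem tendsto_avg_indicator
    (hlim : ∀ c : ℕ → ℕ, Tendsto (fun n => avg fun ω : Ω n =>
      ∏ l ∈ U, ((x n l ω).descFactorial (c l) : ℝ)) atTop (𝓝 (∏ l ∈ U, lam l ^ c l)))
    (hbd : ∀ᶠ n in atTop, ∀ c : ℕ → ℕ, (avg fun ω : Ω n =>
      ∏ l ∈ U, ((x n l ω).descFactorial (c l) : ℝ)) ≤ ∏ l ∈ U, r l ^ c l) (a : ℕ → ℕ) :
    Tendsto (fun n => avg fun ω : Ω n => if ∀ l ∈ U, x n l ω = a l then (1 : ℝ) else 0) atTop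
      (𝓝 (∏ l ∈ U, Real.exp (-lam l) * (lam l ^ a l / (a l)!))) := by
  simpa using tendsto_avg_indicator_mul_descFactorial hlim hbd a U le_rfl (fun _ => 0)
    (fun _ _ => rfl)

end Poisson

/-! ### Cycle counts of random configurations -/

open scoped Classical in
/-- The indicator of a proposition. -/
def ind (p : Prop) : ℝ := if p then 1 else 0

theorem ind_of {p : Prop} (h : p) : ind p = 1 := if_pos h
theorem ind_of_not {p : Prop} (h : ¬ p) : ind p = 0 := if_neg h
theorem ind_nonneg (p : Prop) : 0 ≤ ind p := by
  unfold ind; split_ifs <;> norm_num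
theorem ind_le_one (p : Prop) : ind p ≤ 1 := by
  unfold ind; split_ifs <;> norm_num

theorem uniformProb_configurations {n : ℕ} (d : Fin n → ℕ)
    (p : Set (Sym2 (HalfEdge d)) → Prop) :
    uniformProb (configurations d) p = avg fun M : PerfectMatching (HalfEdge d) => ind (p M.1) := by
  classical
  have h1 : {M | M ∈ configurations d ∧ p M}.ncard =
      Nat.card {M : PerfectMatching (HalfEdge d) // p M.1} := by
    rw [← Nat.card_coe_set_eq]
    exact Nat.card_congr (Equiv.subtypeSubtypeEquivSubtypeInter _ _).symm
  have h2 : (configurations d).ncard = Nat.card (PerfectMatching (HalfEdge d)) := by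
    rw [← Nat.card_coe_set_eq]
    rfl
  rw [uniformProb, avg, h1, h2]
  congr 1
  rw [Nat.card_eq_fintype_card, Fintype.card_subtype, Finset.card_filter]
  push_cast
  refine Finset.sum_congr rfl fun M _ => ?_
  by_cases h : p M.1 <;> simp [ind, h]

/-- The largest degree. -/
def maxDeg {n : ℕ} (d : Fin n → ℕ) : ℕ := Finset.univ.sup d

theorem card_halfEdge_fiber_le {n : ℕ} (d : Fin n → ℕ) (v : Fin n) :
    Nat.card {h : HalfEdge d // h.1 = v} ≤ maxDeg d := by
  have : Nat.card {h : HalfEdge d // h.1 = v} ≤ Nat.card (Fin (d v)) := by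
    refine Nat.card_le_card_of_injective (fun h => Fin.cast (by rw [h.2]) h.1.2) ?_
    rintro ⟨⟨a, i⟩, rfl⟩ ⟨⟨b, j⟩, hb⟩ h
    obtain rfl : b = a := hb
    simp only [Fin.cast_eq_self] at h
    subst h
    rfl
  rw [Nat.card_fin] at this
  exact this.trans (Finset.le_sup (f := d) (Finset.mem_univ v))

/-- The expected number of families of `k` corners that are joined by `k` given pairs. -/
def repMean {n : ℕ} (d : Fin n → ℕ) (k : ℕ) : ℝ :=
  Nat.card (Rep (Sigma.fst : HalfEdge d → Fin n) (Fin k)) * pairProb (Nat.card (HalfEdge d)) k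

/-- A bound for the expected number of families of `k` corners that have an ear of length
`s + 1`. -/
def earMean {n : ℕ} (d : Fin n → ℕ) (k s : ℕ) : ℝ :=
  (Nat.card (Rep (Sigma.fst : HalfEdge d → Fin n) (Fin k)) * ((k * maxDeg d) ^ 2 *
    Nat.card (Corner (Sigma.fst : HalfEdge d → Fin n)) ^ s)) *
    |pairProb (Nat.card (HalfEdge d)) (k + (s + 1))|

/-- The asymptotic properties of a sequence of degree sequences that determine the limiting
distribution of the numbers of cycles. -/
structure CycleAsymptotics (d : (n : ℕ) → Fin n → ℕ) (ν ρ : ℝ) : Prop where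
  nonempty : ∀ n, Nonempty (PerfectMatching (HalfEdge (d n)))
  nonneg : 0 ≤ ν
  lt_one : ν < 1
  rho_nonneg : 0 ≤ ρ
  rho_lt_one : ρ < 1
  tendsto_rep : ∀ k, Tendsto (fun n => repMean (d n) k) atTop (𝓝 (ν ^ k))
  rep_le : ∀ᶠ n in atTop, ∀ k, repMean (d n) k ≤ ρ ^ k
  tendsto_ear : ∀ k s, Tendsto (fun n => earMean (d n) k s) atTop (𝓝 0)

theorem avg_card_inM_eq_repMean {n : ℕ} (d : Fin n → ℕ) [Nonempty (PerfectMatching (HalfEdge d))]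
    {I : Type*} [Finite I] (σ : Equiv.Perm I) :
    avg (fun M : PerfectMatching (HalfEdge d) =>
      (Nat.card {f : Rep (Sigma.fst : HalfEdge d → Fin n) I // f.InM σ M.1} : ℝ)) =
      repMean d (Nat.card I) := by
  rw [avg_card_inM, repMean, card_rep_congr (Finite.equivFin I)]

theorem avg_card_ear_le_earMean {n : ℕ} (d : Fin n → ℕ)
    [Nonempty (PerfectMatching (HalfEdge d))] {I : Type*} [Finite I] (σ : Equiv.Perm I) (L : ℕ) :
    avg (fun M : PerfectMatching (HalfEdge d) =>
      (Nat.card {f : Rep (Sigma.fst : HalfEdge d → Fin n) I //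
        f.InM σ M.1 ∧ ∃ s < L, ∃ u w, IsEar f M.1 s u w} : ℝ)) ≤
      ∑ s ∈ Finset.range L, earMean d (Nat.card I) s := by
  refine (avg_card_ear_le (card_halfEdge_fiber_le d) σ L).trans (le_of_eq ?_)
  simp only [earMean, card_rep_congr (Finite.equivFin I)]

/-- The limit of the expected number of cycles of length `l`. -/
def cycleMean (ν : ℝ) (l : ℕ) : ℝ := ν ^ l / (2 * (l : ℝ))

theorem prod_cycleMean_pow (A : Finset ℕ) (c : ℕ → ℕ) (ν : ℝ) :
    ∏ l ∈ A, cycleMean ν l ^ c l = ν ^ (∑ l ∈ A, l * c l) / ∏ l ∈ A, (2 * (l : ℝ)) ^ c l := by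
  simp only [cycleMean, div_pow]
  rw [Finset.prod_div_distrib]
  congr 1
  rw [← Finset.prod_pow_eq_pow_sum]
  simp only [pow_mul]

section
variable {d : (n : ℕ) → Fin n → ℕ} {ν ρ : ℝ} {A : Finset ℕ}

/-- The number of isolated cycles of a configuration. -/
abbrev isolatedCount (A : Finset ℕ) (d : (n : ℕ) → Fin n → ℕ) (n l : ℕ)
    (M : PerfectMatching (HalfEdge (d n))) : ℕ :=
  isoCount (Sigma.fst : HalfEdge (d n) → Fin n) A M.1 l

/-- Up to the factor `∏ (2 * l) ^ c l` the average is the expected number of good families. Every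
good family lies in the matching, and every family that lies in it is good or has an ear. -/
theorem avg_prod_isolatedCount (h : CycleAsymptotics d ν ρ) (hA : ∀ l ∈ A, 1 ≤ l) (c : ℕ → ℕ)
    (n : ℕ) :
    (avg fun M => ∏ l ∈ A, ((isolatedCount A d n l M).descFactorial (c l) : ℝ)) ≤
        repMean (d n) (∑ l ∈ A, l * c l) / ∏ l ∈ A, (2 * (l : ℝ)) ^ c l ∧
      (repMean (d n) (∑ l ∈ A, l * c l) -
        ∑ s ∈ Finset.range (A.sup id), earMean (d n) (∑ l ∈ A, l * c l) s) /
          ∏ l ∈ A, (2 * (l : ℝ)) ^ c l ≤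
      avg fun M => ∏ l ∈ A, ((isolatedCount A d n l M).descFactorial (c l) : ℝ) := by
  have := h.nonempty n
  have hpos : 0 < ∏ l ∈ A, (2 * (l : ℝ)) ^ c l := by
    refine Finset.prod_pos fun l hl => pow_pos ?_ _
    have : (1 : ℝ) ≤ l := by exact_mod_cast hA l hl
    linarith
  have hgood : (avg fun M : PerfectMatching (HalfEdge (d n)) =>
      (Nat.card {f : Rep (Sigma.fst : HalfEdge (d n) → Fin n) (FamIndex A c) //
        f.IsGood M.1} : ℝ)) = (∏ l ∈ A, (2 * (l : ℝ)) ^ c l) *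
      avg fun M => ∏ l ∈ A, ((isolatedCount A d n l M).descFactorial (c l) : ℝ) := by
    rw [← avg_const_mul]
    congr 1
    funext M
    rw [card_isGood hA M.2]
    push_cast
    rw [Finset.prod_mul_distrib]
  have hrep := avg_card_inM_eq_repMean (d n) (famRot A c)
  have hear := avg_card_ear_le_earMean (d n) (famRot A c) (A.sup id)
  rw [card_famIndex] at hrep hear
  rw [le_div_iff₀ hpos, div_le_iff₀ hpos, mul_comm, ← hgood]
  constructor
  · rw [← hrep]
    refine avg_mono fun M => Nat.cast_le.2 ?_
    exact Nat.card_le_card_of_injective (fun f => ⟨f.1, f.2.1⟩) fun f f' hff =>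
      Subtype.ext (by simpa using hff)
  · rw [sub_le_iff_le_add]
    refine le_trans ?_ (add_le_add_right hear _)
    rw [← hrep, ← avg_add]
    refine avg_mono fun M => ?_
    rw [← Nat.cast_add, Nat.cast_le, ← Nat.card_sum]
    classical
    refine Nat.card_le_card_of_injective (fun f => if hf : f.1.IsGood M.1 then Sum.inl ⟨f.1, hf⟩
      else Sum.inr ⟨f.1, f.2, f.2.exists_ear_of_not_isGood
        (fun l hl => Finset.le_sup (f := id) hl) M.2 hf⟩) ?_
    intro f f' hff
    by_cases h1 : f.1.IsGood M.1 <;> by_cases h2 : f'.1.IsGood M.1 <;> simp [h1, h2] at hff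
    · exact Subtype.ext hff
    · exact Subtype.ext hff

theorem tendsto_prod_isolatedCount (h : CycleAsymptotics d ν ρ) (hA : ∀ l ∈ A, 1 ≤ l)
    (c : ℕ → ℕ) :
    Tendsto (fun n => avg fun M => ∏ l ∈ A, ((isolatedCount A d n l M).descFactorial (c l) : ℝ))
      atTop (𝓝 (∏ l ∈ A, cycleMean ν l ^ c l)) := by
  rw [prod_cycleMean_pow]
  refine tendsto_of_tendsto_of_tendsto_of_le_of_le ?_
    ((h.tendsto_rep _).div_const _) (fun n => (avg_prod_isolatedCount h hA c n).2)
    (fun n => (avg_prod_isolatedCount h hA c n).1)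
  have h1 := (h.tendsto_rep (∑ l ∈ A, l * c l)).sub (tendsto_finsetSum (Finset.range (A.sup id))
    fun s _ => h.tendsto_ear (∑ l ∈ A, l * c l) s)
  simp only [Finset.sum_const_zero, sub_zero] at h1
  exact h1.div_const _

theorem tendsto_ind_isolatedCount (h : CycleAsymptotics d ν ρ) (hA : ∀ l ∈ A, 1 ≤ l)
    (a : ℕ → ℕ) :
    Tendsto (fun n => avg fun M => ind (∀ l ∈ A, isolatedCount A d n l M = a l)) atTop
      (𝓝 (∏ l ∈ A, Real.exp (-cycleMean ν l) * (cycleMean ν l ^ a l / (a l)!))) := by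
  have := tendsto_avg_indicator (x := isolatedCount A d) (U := A) (lam := cycleMean ν)
    (r := cycleMean ρ) (tendsto_prod_isolatedCount h hA) ?_ a
  · convert! this using 4
    unfold ind
    congr
  · filter_upwards [h.rep_le] with n hn c
    refine (avg_prod_isolatedCount h hA c n).1.trans ?_
    rw [prod_cycleMean_pow]
    exact div_le_div_of_nonneg_right (hn _) (Finset.prod_nonneg fun l _ => by positivity)

/-- The number of cycles of a configuration. -/
abbrev cycleCount (d : (n : ℕ) → Fin n → ℕ) (n l : ℕ)
    (M : PerfectMatching (HalfEdge (d n))) : ℕ :=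
  (cycles (Sigma.fst : HalfEdge (d n) → Fin n) M.1 l).ncard

/-- If the two counts differ, some cycle is not isolated and hence has an ear. The second
alternative has the form needed for Markov's inequality. -/
theorem isolatedCount_eq_or (n : ℕ) (M : PerfectMatching (HalfEdge (d n))) {l : ℕ} :
    isolatedCount A d n l M = cycleCount d n l M ∨
      1 ≤ Nat.card {f : Rep (Sigma.fst : HalfEdge (d n) → Fin n) (Fin l) //
        f.InM (finRotate l) M.1 ∧ ∃ s < A.sup id, ∃ u w, IsEar f M.1 s u w} := by
  by_cases h : ∀ C ∈ cycles (Sigma.fst : HalfEdge (d n) → Fin n) M.1 l,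
      IsIsolated (Sigma.fst : HalfEdge (d n) → Fin n) A M.1 C
  · left
    rw [cycleCount, ← Nat.card_coe_set_eq]
    exact Nat.card_congr (Equiv.subtypeEquivRight fun C => and_iff_left_of_imp (h C))
  · right
    push Not at h
    obtain ⟨C, ⟨f, hf, rfl⟩, hC⟩ := h
    have hear := hf.exists_ear_of_not_isIsolated (L := A.sup id)
      (fun l hl => Finset.le_sup (f := id) hl) M.2 le_rfl (fun i₀ _ => ?_) hC
    · have : Nonempty {f : Rep (Sigma.fst : HalfEdge (d n) → Fin n) (Fin l) //
        f.InM (finRotate l) M.1 ∧ ∃ s < A.sup id, ∃ u w, IsEar f M.1 s u w} := ⟨f, hf, hear⟩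
      exact Nat.card_pos
    · have : {i | (finRotate l).SameCycle i₀ i} = Set.univ :=
        Set.eq_univ_of_forall fun i => sameCycle_finRotate i₀ i
      rw [this, Set.image_univ, Rep.edges]

/-- The indicators for isolated cycles and for all cycles can differ only where the number `E` of
cyclic families with an ear is at least 1, and the mean of `E` tends to 0. -/
theorem tendsto_ind_cycleCount (h : CycleAsymptotics d ν ρ) (hA : ∀ l ∈ A, 1 ≤ l) (a : ℕ → ℕ) :
    Tendsto (fun n => avg fun M => ind (∀ l ∈ A, cycleCount d n l M = a l)) atTop
      (𝓝 (∏ l ∈ A, Real.exp (-cycleMean ν l) * (cycleMean ν l ^ a l / (a l)!))) := by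
  let E : ∀ n, PerfectMatching (HalfEdge (d n)) → ℝ := fun n M => ∑ l ∈ A,
    (Nat.card {f : Rep (Sigma.fst : HalfEdge (d n) → Fin n) (Fin l) //
        f.InM (finRotate l) M.1 ∧ ∃ s < A.sup id, ∃ u w, IsEar f M.1 s u w} : ℝ)
  have hE0 : ∀ n M, 0 ≤ E n M := fun n M => Finset.sum_nonneg fun l _ => Nat.cast_nonneg _
  have hE : Tendsto (fun n => avg (E n)) atTop (𝓝 0) := by
    have h1 : Tendsto (fun n => ∑ l ∈ A, ∑ s ∈ Finset.range (A.sup id), earMean (d n) l s)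
        atTop (𝓝 0) := by
      have := tendsto_finsetSum A fun l _ => tendsto_finsetSum (Finset.range (A.sup id))
        fun s _ => h.tendsto_ear l s
      simpa using this
    refine squeeze_zero (fun n => avg_nonneg (hE0 n)) (fun n => ?_) h1
    have := h.nonempty n
    simp only [E]
    rw [avg_sum]
    refine Finset.sum_le_sum fun l _ => ?_
    have := avg_card_ear_le_earMean (d n) (finRotate l) (A.sup id)
    rwa [Nat.card_fin] at this
  have key : ∀ n M, (ind (∀ l ∈ A, cycleCount d n l M = a l) ≤
      ind (∀ l ∈ A, isolatedCount A d n l M = a l) + E n M) ∧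
      (ind (∀ l ∈ A, isolatedCount A d n l M = a l) ≤
      ind (∀ l ∈ A, cycleCount d n l M = a l) + E n M) := by
    intro n M
    by_cases hall : ∀ l ∈ A, isolatedCount A d n l M = cycleCount d n l M
    · have : (∀ l ∈ A, cycleCount d n l M = a l) ↔ ∀ l ∈ A, isolatedCount A d n l M = a l :=
        forall₂_congr fun l hl => by rw [hall l hl]
      rw [this]
      have := hE0 n M
      constructor <;> linarith
    · push Not at hall
      obtain ⟨l, hl, hne⟩ := hall
      have h1 := (isolatedCount_eq_or (A := A) n M (l := l)).resolve_left hne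
      have h2 : 1 ≤ E n M := by
        refine le_trans ?_ (Finset.single_le_sum (f := fun l =>
          (Nat.card {f : Rep (Sigma.fst : HalfEdge (d n) → Fin n) (Fin l) //
            f.InM (finRotate l) M.1 ∧ ∃ s < A.sup id, ∃ u w, IsEar f M.1 s u w} : ℝ))
          (fun l _ => Nat.cast_nonneg _) hl)
        exact_mod_cast h1
      constructor
      · linarith [ind_le_one (∀ l ∈ A, cycleCount d n l M = a l),
          ind_nonneg (∀ l ∈ A, isolatedCount A d n l M = a l)]
      · linarith [ind_nonneg (∀ l ∈ A, cycleCount d n l M = a l),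
          ind_le_one (∀ l ∈ A, isolatedCount A d n l M = a l)]
  have hiso := tendsto_ind_isolatedCount h hA a
  have hlow := hiso.sub hE
  have hup := hiso.add hE
  rw [sub_zero] at hlow
  rw [add_zero] at hup
  refine tendsto_of_tendsto_of_tendsto_of_le_of_le hlow hup (fun n => ?_) (fun n => ?_)
  · simp only
    rw [sub_le_iff_le_add, ← avg_add]
    exact avg_mono fun M => (key n M).2
  · simp only
    rw [← avg_add]
    exact avg_mono fun M => (key n M).1

theorem tendsto_uniformProb_finset (h : CycleAsymptotics d ν ρ) (hA : ∀ l ∈ A, 1 ≤ l)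
    (a : ℕ → ℕ) :
    Tendsto (fun n => uniformProb (configurations (d n))
      (fun M => ∀ l ∈ A, numCycles (multigraph M) l = a l)) atTop
      (𝓝 (∏ l ∈ A, Real.exp (-cycleMean ν l) * (cycleMean ν l ^ a l / (a l)!))) := by
  refine (tendsto_ind_cycleCount h hA a).congr fun n => ?_
  rw [uniformProb_configurations]
  congr 1
  funext M
  congr 1
  exact propext (forall₂_congr fun l _ => by rw [numCycles_multigraph M.2])

/-! ### Long cycles -/

/-- Union bound over the lengths, of which only those up to `m` matter as a cycle uses `2 * l`
half-edges; the expected numbers of cyclic families are dominated by a geometric series. -/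
theorem avg_ind_exists_long_cycle_le (h : CycleAsymptotics d ν ρ) (L : ℕ) :
    ∀ᶠ n in atTop, (avg fun M => ind (∃ l, L < l ∧ cycleCount d n l M ≠ 0)) ≤
      ρ ^ (L + 1) / (1 - ρ) := by
  filter_upwards [h.rep_le] with n hn
  have := h.nonempty n
  set m := Nat.card (HalfEdge (d n))
  have h1 : (avg fun M => ind (∃ l, L < l ∧ cycleCount d n l M ≠ 0)) ≤
      ∑ l ∈ Finset.Ioc L m, repMean (d n) l := by
    have h2 : ∀ l, repMean (d n) l = avg (fun M : PerfectMatching (HalfEdge (d n)) =>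
        (Nat.card {f : Rep (Sigma.fst : HalfEdge (d n) → Fin n) (Fin l) //
          f.InM (finRotate l) M.1} : ℝ)) := by
      intro l
      rw [avg_card_inM_eq_repMean, Nat.card_fin]
    simp only [h2]
    rw [← avg_sum]
    refine avg_mono fun M => ?_
    by_cases hM : ∃ l, L < l ∧ cycleCount d n l M ≠ 0
    · rw [ind_of hM]
      obtain ⟨l, hl, hc⟩ := hM
      obtain ⟨C, f, hf, -⟩ := Set.nonempty_of_ncard_ne_zero hc
      have hlm : 2 * l ≤ m := two_mul_le_of_card_rep f
      refine le_trans ?_ (Finset.single_le_sum (f := fun l =>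
          (Nat.card {f : Rep (Sigma.fst : HalfEdge (d n) → Fin n) (Fin l) //
            f.InM (finRotate l) M.1} : ℝ))
          (fun l _ => Nat.cast_nonneg _) (Finset.mem_Ioc.2 ⟨hl, by omega⟩))
      have : Nonempty {f : Rep (Sigma.fst : HalfEdge (d n) → Fin n) (Fin l) //
            f.InM (finRotate l) M.1} := ⟨f, hf⟩
      exact_mod_cast Nat.card_pos
    · rw [ind_of_not hM]
      exact Finset.sum_nonneg fun l _ => Nat.cast_nonneg _
  refine h1.trans ((Finset.sum_le_sum fun l _ => hn l).trans ?_)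
  have h3 : ∑ l ∈ Finset.Ioc L m, ρ ^ l ≤ ∑' k : ℕ, ρ ^ (k + (L + 1)) := by
    have hs : Summable fun k : ℕ => ρ ^ (k + (L + 1)) :=
      (summable_nat_add_iff (L + 1)).2 (summable_geometric_of_lt_one h.rho_nonneg h.rho_lt_one)
    have h4 : ∑ l ∈ Finset.Ioc L m, ρ ^ l = ∑ k ∈ Finset.range (m - L), ρ ^ (k + (L + 1)) := by
      rw [← Finset.Ico_add_one_add_one_eq_Ioc, Finset.sum_Ico_eq_sum_range]
      rw [show m + 1 - (L + 1) = m - L by omega]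
      exact Finset.sum_congr rfl fun k _ => by rw [add_comm]
    rw [h4]
    exact hs.sum_le_tsum _ fun k _ => pow_nonneg h.rho_nonneg _
  refine h3.trans (le_of_eq ?_)
  simp only [pow_add ρ _ (L + 1)]
  rw [tsum_mul_right, tsum_geometric_of_lt_one h.rho_nonneg h.rho_lt_one]
  ring

/-- The exponents sum to half of the Taylor series of `log (1 - ν)`. -/
theorem tendsto_prod_exp_neg_cycleMean (hν0 : 0 ≤ ν) (hν1 : ν < 1) :
    Tendsto (fun L => ∏ l ∈ Finset.Icc 1 L, Real.exp (-cycleMean ν l)) atTop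
      (𝓝 (Real.sqrt (1 - ν))) := by
  have h1 := (Real.hasSum_pow_div_log_of_abs_lt_one
    (x := ν) (by rwa [abs_of_nonneg hν0])).tendsto_sum_nat
  have h2 : Real.sqrt (1 - ν) = Real.exp (-((-Real.log (1 - ν)) / 2)) := by
    rw [Real.sqrt_eq_rpow, Real.rpow_def_of_pos (by linarith)]
    ring_nf
  rw [h2]
  have h3 := (Real.continuous_exp.tendsto _).comp (h1.div_const 2).neg
  refine h3.congr fun L => ?_
  rw [Function.comp_apply, ← Real.exp_sum]
  congr 1
  rw [Finset.sum_div, ← Finset.sum_neg_distrib, ← Finset.Ico_add_one_right_eq_Icc,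
    Finset.sum_Ico_eq_sum_range]
  refine Finset.sum_congr rfl fun k _ => ?_
  rw [cycleMean, add_comm 1 k]
  push_cast
  field_simp

theorem finprod_cycleMean_eq {k : ℕ} {a : ℕ → ℕ} {L : ℕ} (hL : ∀ l, a l ≠ 0 → l ≤ L) :
    ∏ᶠ (l : ℕ) (_ : k ≤ l), (ν ^ l / (2 * (l : ℝ))) ^ (a l) / ((a l)! : ℝ) =
      ∏ l ∈ Finset.Icc k L, cycleMean ν l ^ a l / (a l)! := by
  apply finprod_cond_eq_prod_of_cond_iff
  intro l hl
  have : a l ≠ 0 := by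
    intro h0
    simp [h0] at hl
  simp [hL l this]

theorem tendsto_uniformProb_all (h : CycleAsymptotics d ν ρ) (a : ℕ → ℕ)
    (ha : (Function.support a).Finite) :
    Tendsto (fun n => uniformProb (configurations (d n))
      (fun M => ∀ l, 1 ≤ l → numCycles (multigraph M) l = a l)) atTop
      (𝓝 (Real.sqrt (1 - ν) * ∏ᶠ (l : ℕ) (_ : 1 ≤ l),
        (ν ^ l / (2 * (l : ℝ))) ^ (a l) / ((a l)! : ℝ))) := by
  obtain ⟨L₀, hL₀⟩ : ∃ L₀, ∀ l, a l ≠ 0 → l ≤ L₀ := by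
    obtain ⟨B, hB⟩ := ha.bddAbove
    exact ⟨B, fun l hl => hB hl⟩
  set P := ∏ᶠ (l : ℕ) (_ : 1 ≤ l), (ν ^ l / (2 * (l : ℝ))) ^ (a l) / ((a l)! : ℝ) with hP
  let G : ℕ → ℝ := fun L => ∏ l ∈ Finset.Icc 1 L,
    Real.exp (-cycleMean ν l) * (cycleMean ν l ^ a l / (a l)!)
  have hG : Tendsto G atTop (𝓝 (Real.sqrt (1 - ν) * P)) := by
    refine ((tendsto_prod_exp_neg_cycleMean h.nonneg h.lt_one).mul_const P).congr' ?_
    filter_upwards [eventually_ge_atTop L₀] with L hL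
    simp only [G]
    rw [Finset.prod_mul_distrib, hP, finprod_cycleMean_eq fun l hl => (hL₀ l hl).trans hL]
  have hfun : ∀ n, uniformProb (configurations (d n))
      (fun M => ∀ l, 1 ≤ l → numCycles (multigraph M) l = a l) =
      avg fun M => ind (∀ l, 1 ≤ l → cycleCount d n l M = a l) := by
    intro n
    rw [uniformProb_configurations]
    congr 1
    funext M
    congr 1
    exact propext (forall₂_congr fun l _ => by rw [numCycles_multigraph M.2])
  simp only [hfun]
  have htail : Tendsto (fun L : ℕ => ρ ^ (L + 1) / (1 - ρ)) atTop (𝓝 0) := by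
    have := ((tendsto_add_atTop_iff_nat 1).2
      (tendsto_pow_atTop_nhds_zero_of_lt_one h.rho_nonneg h.rho_lt_one)).div_const (1 - ρ)
    simpa using this
  rw [Metric.tendsto_atTop]
  intro ε hε
  -- The cut-off `L` is chosen before `n`: beyond the support of `a`, with the finite product within
  -- `ε / 3` of its limit and the bound for longer cycles below `ε / 3`. The last third is the
  -- convergence in `n` for the lengths up to `L`.
  obtain ⟨L, hL, hL1, hL2⟩ := ((eventually_ge_atTop L₀).and
    ((hG.eventually (Metric.ball_mem_nhds _ (by positivity : 0 < ε / 3))).and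
    (htail.eventually (Iio_mem_nhds (by positivity : 0 < ε / 3))))).exists
  have hfin := tendsto_ind_cycleCount h (A := Finset.Icc 1 L)
    (fun l hl => (Finset.mem_Icc.1 hl).1) a
  have h1 := hfin.eventually (Metric.ball_mem_nhds _ (by positivity : 0 < ε / 3))
  rw [← eventually_atTop]
  filter_upwards [h1, avg_ind_exists_long_cycle_le h L] with n hn1 hn2
  have hle : (avg fun M => ind (∀ l, 1 ≤ l → cycleCount d n l M = a l)) ≤
      avg fun M => ind (∀ l ∈ Finset.Icc 1 L, cycleCount d n l M = a l) := by
    refine avg_mono fun M => ?_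
    by_cases hM : ∀ l, 1 ≤ l → cycleCount d n l M = a l
    · rw [ind_of hM, ind_of fun l hl => hM l (Finset.mem_Icc.1 hl).1]
    · rw [ind_of_not hM]
      exact ind_nonneg _
  have hge : (avg fun M => ind (∀ l ∈ Finset.Icc 1 L, cycleCount d n l M = a l)) ≤
      (avg fun M => ind (∀ l, 1 ≤ l → cycleCount d n l M = a l)) +
      avg fun M => ind (∃ l, L < l ∧ cycleCount d n l M ≠ 0) := by
    rw [← avg_add]
    refine avg_mono fun M => ?_
    by_cases hM : ∃ l, L < l ∧ cycleCount d n l M ≠ 0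
    · rw [ind_of hM]
      linarith [ind_le_one (∀ l ∈ Finset.Icc 1 L, cycleCount d n l M = a l),
        ind_nonneg (∀ l, 1 ≤ l → cycleCount d n l M = a l)]
    · have : (∀ l, 1 ≤ l → cycleCount d n l M = a l) ↔
          ∀ l ∈ Finset.Icc 1 L, cycleCount d n l M = a l := by
        refine ⟨fun h l hl => h l (Finset.mem_Icc.1 hl).1, fun h l hl => ?_⟩
        rcases le_or_gt l L with hlL | hlL
        · exact h l (Finset.mem_Icc.2 ⟨hl, hlL⟩)
        · push Not at hM
          rw [hM l hlL]
          by_contra hne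
          exact absurd (hL₀ l (Ne.symm hne)) (by omega)
      rw [this]
      linarith [ind_nonneg (∃ l, L < l ∧ cycleCount d n l M ≠ 0)]
  rw [Real.dist_eq, abs_lt] at hn1
  have hL1' : dist (G L) (Real.sqrt (1 - ν) * P) < ε / 3 := hL1
  rw [Real.dist_eq, abs_lt] at hL1'
  have hL2' : ρ ^ (L + 1) / (1 - ρ) < ε / 3 := hL2
  simp only [G] at hL1'
  rw [Real.dist_eq, abs_lt]
  constructor <;> linarith [hn1.1, hn1.2, hL1'.1, hL1'.2]

end

/-! ### Asymptotics of degree sequences -/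

theorem card_halfEdge {n : ℕ} (d : Fin n → ℕ) : Nat.card (HalfEdge d) = ∑ v, d v := by
  rw [Nat.card_sigma]
  simp

/-- A corner is a pair of different half-edges of some vertex. -/
def cornerEquiv {n : ℕ} (d : Fin n → ℕ) : Corner (Sigma.fst : HalfEdge d → Fin n) ≃
    Σ v, {p : Fin (d v) × Fin (d v) // p.1 ≠ p.2} where
  toFun x := ⟨x.vert, (x.inn.2, Fin.cast (congrArg d x.map_out) x.out.2), by
    obtain ⟨⟨⟨v, i⟩, ⟨w, j⟩⟩, h, hne⟩ := x
    obtain rfl : v = w := h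
    intro hij
    apply hne
    have : i = j := hij
    rw [this]⟩
  invFun y := Corner.mk ⟨y.1, y.2.1.1⟩ ⟨y.1, y.2.1.2⟩ rfl fun h => y.2.2 (by simpa using h)
  left_inv x := by
    obtain ⟨⟨⟨v, i⟩, ⟨w, j⟩⟩, h, hne⟩ := x
    obtain rfl : v = w := h
    rfl
  right_inv y := rfl

theorem card_corner {n : ℕ} (d : Fin n → ℕ) :
    (Nat.card (Corner (Sigma.fst : HalfEdge d → Fin n)) : ℝ) =
      ∑ v, (d v : ℝ) ^ 2 - ∑ v, (d v : ℝ) := by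
  rw [Nat.card_congr (cornerEquiv d), Nat.card_sigma, Nat.cast_sum, ← Finset.sum_sub_distrib]
  refine Finset.sum_congr rfl fun v _ => ?_
  have h1 : Nat.card {p : Fin (d v) × Fin (d v) // p.1 ≠ p.2} = d v * d v - d v := by
    have := Finset.offDiag_card (Finset.univ : Finset (Fin (d v)))
    rw [Finset.card_univ, Fintype.card_fin] at this
    rw [← this, Nat.card_eq_fintype_card, Fintype.card_subtype]
    congr 1
    ext p
    simp
  rw [h1, Nat.cast_sub (Nat.le_mul_self _)]
  push_cast
  ring

section Limits
variable {d : (n : ℕ) → Fin n → ℕ} {ν : ℝ}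

theorem tendsto_pow_mul_pairProb {m : ℕ → ℕ} (hm : Tendsto m atTop atTop) (k : ℕ) :
    Tendsto (fun n => (m n : ℝ) ^ k * pairProb (m n) k) atTop (𝓝 1) := by
  have h1 : ∀ i : ℕ, Tendsto (fun n => (m n : ℝ) * ((m n : ℝ) - (2 * i + 1))⁻¹) atTop (𝓝 1) := by
    intro i
    have hm' : Tendsto (fun n => (m n : ℝ)) atTop atTop := tendsto_natCast_atTop_atTop.comp hm
    have h2 : Tendsto (fun n => 1 - (2 * (i : ℝ) + 1) / (m n : ℝ)) atTop (𝓝 1) := by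
      simpa using tendsto_const_nhds.sub (hm'.const_div_atTop (2 * (i : ℝ) + 1))
    have h3 := h2.inv₀ one_ne_zero
    rw [inv_one] at h3
    refine h3.congr' ?_
    filter_upwards [hm'.eventually_gt_atTop 0] with n hn
    rw [one_sub_div hn.ne', inv_div, div_eq_mul_inv]
  have h2 := tendsto_finsetProd (Finset.range k) fun i _ => h1 i
  simp only [Finset.prod_const_one] at h2
  refine h2.congr fun n => ?_
  rw [Finset.prod_mul_distrib, Finset.prod_const, Finset.card_range, pairProb]

/-- Each further corner contributes a factor between `(S - k * Δ ^ 2) / m` and `S / m`, both of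
which tend to `ν`. -/
theorem tendsto_card_rep_div_pow
    (hS : Tendsto (fun n => (Nat.card (Corner (Sigma.fst : HalfEdge (d n) → Fin n)) : ℝ) /
      Nat.card (HalfEdge (d n))) atTop (𝓝 ν))
    (hΔ : Tendsto (fun n => (maxDeg (d n) : ℝ) ^ 2 / Nat.card (HalfEdge (d n))) atTop (𝓝 0))
    (k : ℕ) :
    Tendsto (fun n => (Nat.card (Rep (Sigma.fst : HalfEdge (d n) → Fin n) (Fin k)) : ℝ) /
      (Nat.card (HalfEdge (d n)) : ℝ) ^ k) atTop (𝓝 (ν ^ k)) := by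
  induction k with
  | zero => simp only [card_rep_zero, pow_zero, Nat.cast_one, div_one, tendsto_const_nhds]
  | succ k ih =>
    have hup := ih.mul hS
    have hlow := ih.mul (hS.sub (hΔ.const_mul (k : ℝ)))
    rw [mul_zero, sub_zero] at hlow
    rw [pow_succ]
    refine tendsto_of_tendsto_of_tendsto_of_le_of_le hlow hup (fun n => ?_) (fun n => ?_)
    · simp only
      rw [← mul_div_assoc, ← sub_div, div_mul_div_comm, ← pow_succ]
      refine div_le_div_of_nonneg_right ?_ (by positivity)
      refine le_trans ?_ (Nat.cast_le.2
        (card_rep_succ_ge k (maxDeg (d n)) (card_halfEdge_fiber_le (d n))))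
      rw [Nat.cast_mul]
      refine mul_le_mul_of_nonneg_left ?_ (Nat.cast_nonneg _)
      rw [sub_le_iff_le_add]
      have h1 : Nat.card (Corner (Sigma.fst : HalfEdge (d n) → Fin n)) ≤
          Nat.card (Corner (Sigma.fst : HalfEdge (d n) → Fin n)) - k * maxDeg (d n) ^ 2 +
            k * maxDeg (d n) ^ 2 := le_tsub_add
      exact_mod_cast h1
    · simp only
      rw [div_mul_div_comm, ← pow_succ]
      refine div_le_div_of_nonneg_right ?_ (by positivity)
      exact_mod_cast (card_rep_succ_le k).trans (Nat.mul_le_mul_left _ (Nat.sub_le _ _))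

/-- Taking `ρ` midway between `ν` and 1 leaves room for `S < ρ * (m - 1)` from some `n` on, which is
all that the uniform bound requires. -/
theorem cycleAsymptotics_of_tendsto (hne : ∀ n, Nonempty (PerfectMatching (HalfEdge (d n))))
    (hν0 : 0 ≤ ν) (hν1 : ν < 1)
    (hm : Tendsto (fun n => Nat.card (HalfEdge (d n))) atTop atTop)
    (hS : Tendsto (fun n => (Nat.card (Corner (Sigma.fst : HalfEdge (d n) → Fin n)) : ℝ) /
      Nat.card (HalfEdge (d n))) atTop (𝓝 ν))
    (hΔ : Tendsto (fun n => (maxDeg (d n) : ℝ) ^ 2 / Nat.card (HalfEdge (d n))) atTop (𝓝 0)) :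
    CycleAsymptotics d ν ((1 + ν) / 2) := by
  have hm' : Tendsto (fun n => (Nat.card (HalfEdge (d n)) : ℝ)) atTop atTop :=
    tendsto_natCast_atTop_atTop.comp hm
  refine ⟨hne, hν0, hν1, by linarith, by linarith, fun k => ?_, ?_, fun k s => ?_⟩
  · have := (tendsto_card_rep_div_pow hS hΔ k).mul (tendsto_pow_mul_pairProb hm k)
    rw [mul_one] at this
    refine this.congr' ?_
    filter_upwards [hm'.eventually_gt_atTop 0] with n hn
    rw [repMean]
    field_simp
  · have h1 : Tendsto (fun n => (1 + ν) / 2 * (1 - 1 / (Nat.card (HalfEdge (d n)) : ℝ))) atTop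
        (𝓝 ((1 + ν) / 2)) := by
      have := ((hm'.const_div_atTop (1 : ℝ)).const_sub 1).const_mul ((1 + ν) / 2)
      rwa [sub_zero, mul_one] at this
    filter_upwards [hS.eventually_lt h1 (by linarith), hm'.eventually_gt_atTop 0] with n hn hn0 k
    refine card_rep_mul_pairProb_le (by linarith) (by linarith) ?_ k
    rw [div_lt_iff₀ hn0] at hn
    refine hn.le.trans (le_of_eq ?_)
    field_simp
  -- The powers of `m` are distributed as `k` for the family, 1 for `Δ ^ 2` and `s` for the inner
  -- corners; together they balance the `k + s + 1` pairs, and the factor `Δ ^ 2 / m` forces the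
  -- limit 0.
  · have h1 := (((tendsto_card_rep_div_pow hS hΔ k).mul
      ((hΔ.const_mul ((k : ℝ) ^ 2)).mul (hS.pow s))).mul
      (tendsto_pow_mul_pairProb hm (k + (s + 1))).abs)
    rw [mul_zero, zero_mul, mul_zero, zero_mul] at h1
    refine h1.congr' ?_
    filter_upwards [hm'.eventually_gt_atTop 0] with n hn
    rw [earMean, abs_mul, abs_of_pos (pow_pos hn _), pow_add, pow_succ, div_pow]
    field_simp
    ring

theorem cycleAsymptotics_of_isEmpty (h : ∀ n, IsEmpty (HalfEdge (d n)))
    (hne : ∀ n, Nonempty (PerfectMatching (HalfEdge (d n)))) : CycleAsymptotics d 0 0 := by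
  have hQ : ∀ n k, Nat.card (Rep (Sigma.fst : HalfEdge (d n) → Fin n) (Fin (k + 1))) = 0 := by
    intro n k
    have : IsEmpty (Rep (Sigma.fst : HalfEdge (d n) → Fin n) (Fin (k + 1))) :=
      ⟨fun f => (h n).false (f 0).inn⟩
    exact Nat.card_of_isEmpty
  have hrep : ∀ n k, repMean (d n) k = 0 ^ k := by
    intro n k
    cases k with
    | zero => rw [repMean, card_rep_zero]; simp [pairProb]
    | succ k => simp [repMean, hQ]
  refine ⟨hne, le_rfl, one_pos, le_rfl, one_pos, fun k => ?_, ?_, fun k s => ?_⟩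
  · simp only [hrep]
    exact tendsto_const_nhds
  · exact Eventually.of_forall fun n k => (hrep n k).le
  · have : ∀ n, earMean (d n) k s = 0 := by
      intro n
      cases k with
      -- An ear needs a vertex of the family to start from: the factor `k` vanishes.
      | zero => simp [earMean]
      | succ k => simp [earMean, hQ]
    simp only [this]
    exact tendsto_const_nhds

end Limits

section Assumption
variable {d : (n : ℕ) → Fin n → ℕ} {D : PMF ℕ}

theorem Assumption.summable_mean (hd : Assumption d D) :
    Summable fun k : ℕ => (D k).toReal * (k : ℝ) := by
  refine Summable.of_nonneg_of_le (fun k => by positivity) (fun k => ?_) hd.summable_sq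
  refine mul_le_mul_of_nonneg_left ?_ ENNReal.toReal_nonneg
  exact_mod_cast Nat.le_self_pow two_ne_zero k

theorem Assumption.expect_mul_sub_one (hd : Assumption d D) :
    expect D (fun k => (k : ℝ) * ((k : ℝ) - 1)) =
      expect D (fun k => (k : ℝ) ^ 2) - expect D (fun k => (k : ℝ)) := by
  rw [expect, expect, expect, ← hd.summable_sq.tsum_sub hd.summable_mean]
  exact tsum_congr fun k => by ring

theorem expect_nonneg (D : PMF ℕ) {f : ℕ → ℝ} (hf : ∀ k, 0 ≤ f k) : 0 ≤ expect D f :=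
  tsum_nonneg fun k => mul_nonneg ENNReal.toReal_nonneg (hf k)

theorem nu_nonneg (D : PMF ℕ) : 0 ≤ nu D := by
  refine div_nonneg (expect_nonneg D fun k => ?_) (expect_nonneg D fun k => Nat.cast_nonneg k)
  rcases Nat.eq_zero_or_pos k with rfl | hk
  · simp
  · have : (1 : ℝ) ≤ k := by exact_mod_cast hk
    exact mul_nonneg (Nat.cast_nonneg _) (by linarith)

/-- Mean zero forces `D k = 0` for every `k ≠ 0`, and degrees of probability zero do not occur.
Convergence alone would allow a few edges. -/
theorem Assumption.isEmpty_halfEdge (hd : Assumption d D)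
    (h0 : expect D (fun k => (k : ℝ)) = 0) (n : ℕ) : IsEmpty (HalfEdge (d n)) := by
  refine ⟨fun ⟨v, i⟩ => ?_⟩
  have h1 := (hasSum_zero_iff_of_nonneg (f := fun k : ℕ => (D k).toReal * (k : ℝ))
    (fun k => by positivity)).1 (by
      have := hd.summable_mean.hasSum
      rwa [← expect, h0] at this)
  have h2 := congrFun h1 (d n v)
  have hpos : d n v ≠ 0 := fun h => (Fin.cast h i).elim0
  have h3 : D (d n v) = 0 := by
    have : (D (d n v)).toReal = 0 := by simpa [hpos] using h2
    exact (ENNReal.toReal_eq_zero_iff _).1 this |>.resolve_right (D.apply_ne_top _)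
  have h4 := hd.degreeCount_eq_zero _ h3 n
  rw [degreeCount, Set.ncard_eq_zero] at h4
  exact (Set.ext_iff.1 h4 v).1 rfl

/-- The bracket is the sum of the squares of all degrees above `R`; if the largest degree exceeds
`R`, its square is one of the terms. -/
theorem sq_maxDeg_le {n : ℕ} (d : Fin n → ℕ) (R : ℕ) :
    (maxDeg d : ℝ) ^ 2 ≤ (R : ℝ) ^ 2 + (∑ v, (d v : ℝ) ^ 2 -
      ∑ k ∈ Finset.range (R + 1), (k : ℝ) ^ 2 * degreeCount d k) := by
  classical
  have h1 : ∑ k ∈ Finset.range (R + 1), (k : ℝ) ^ 2 * degreeCount d k =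
      ∑ v with d v < R + 1, (d v : ℝ) ^ 2 := by
    rw [← Finset.sum_fiberwise_of_maps_to (s := Finset.univ.filter fun v => d v < R + 1)
      (t := Finset.range (R + 1)) (g := d) (fun v hv => by simpa using hv)]
    refine Finset.sum_congr rfl fun k hk => ?_
    have h2 : Finset.filter (fun v => d v = k) (Finset.univ.filter fun v => d v < R + 1) =
        Finset.univ.filter fun v => d v = k := by
      ext v
      simp only [Finset.mem_filter, Finset.mem_univ, true_and, and_iff_right_iff_imp]
      rintro rfl
      exact Finset.mem_range.1 hk
    rw [h2, Finset.sum_congr rfl (g := fun _ => (k : ℝ) ^ 2)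
      (fun v hv => by rw [(Finset.mem_filter.1 hv).2]), Finset.sum_const, nsmul_eq_mul, mul_comm,
      degreeCount, Set.ncard_eq_toFinset_card']
    simp
  have h3 := Finset.sum_filter_add_sum_filter_not Finset.univ (fun v => d v < R + 1)
    (fun v => (d v : ℝ) ^ 2)
  have h4 : 0 ≤ ∑ v with ¬ d v < R + 1, (d v : ℝ) ^ 2 :=
    Finset.sum_nonneg fun v _ => by positivity
  rw [h1, ← h3, add_sub_cancel_left]
  rcases le_or_gt (maxDeg d) R with h | h
  · have : (maxDeg d : ℝ) ^ 2 ≤ (R : ℝ) ^ 2 := by gcongr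
    linarith
  · have hne : (Finset.univ : Finset (Fin n)).Nonempty := by
      rw [Finset.nonempty_iff_ne_empty]
      intro h0
      simp [maxDeg, h0] at h
    obtain ⟨v, -, hv⟩ := Finset.exists_mem_eq_sup _ hne d
    have h5 : (d v : ℝ) ^ 2 ≤ ∑ v with ¬ d v < R + 1, (d v : ℝ) ^ 2 := by
      refine Finset.single_le_sum (f := fun v => (d v : ℝ) ^ 2) (fun v _ => by positivity) ?_
      simp only [Finset.mem_filter, Finset.mem_univ, true_and, not_lt]
      rw [maxDeg, hv] at h
      exact h
    rw [maxDeg, hv]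
    nlinarith [sq_nonneg (R : ℝ)]

/-- For fixed `R` the limit superior is at most the part of the second moment of `D` above `R`,
because both the second moments and the individual probabilities converge. This tail tends to 0 as
`R` grows. -/
theorem Assumption.tendsto_sq_maxDeg_div (hd : Assumption d D) :
    Tendsto (fun n : ℕ => (maxDeg (d n) : ℝ) ^ 2 / n) atTop (𝓝 0) := by
  have hbound : ∀ R n : ℕ, (maxDeg (d n) : ℝ) ^ 2 / n ≤ (R : ℝ) ^ 2 / n +
      (empiricalExpect (d n) (fun k => (k : ℝ) ^ 2) -
        ∑ k ∈ Finset.range (R + 1), (k : ℝ) ^ 2 * ((degreeCount (d n) k : ℝ) / n)) := by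
    intro R n
    rw [empiricalExpect, show ∑ k ∈ Finset.range (R + 1), (k : ℝ) ^ 2 *
      ((degreeCount (d n) k : ℝ) / n) = (∑ k ∈ Finset.range (R + 1), (k : ℝ) ^ 2 *
      (degreeCount (d n) k : ℝ)) / n by rw [Finset.sum_div]; simp only [mul_div_assoc],
      ← sub_div, ← add_div]
    exact div_le_div_of_nonneg_right (sq_maxDeg_le (d n) R) (Nat.cast_nonneg _)
  have hlim : ∀ R : ℕ, Tendsto (fun n : ℕ => (R : ℝ) ^ 2 / n +
      (empiricalExpect (d n) (fun k => (k : ℝ) ^ 2) -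
        ∑ k ∈ Finset.range (R + 1), (k : ℝ) ^ 2 * ((degreeCount (d n) k : ℝ) / n))) atTop
      (𝓝 (0 + (expect D (fun k => (k : ℝ) ^ 2) -
        ∑ k ∈ Finset.range (R + 1), (k : ℝ) ^ 2 * (D k).toReal))) := by
    intro R
    refine (tendsto_natCast_atTop_atTop.const_div_atTop _).add (hd.tendsto_sq.sub ?_)
    exact tendsto_finsetSum _ fun k _ => (hd.tendsto_distr k).const_mul _
  have htail : Tendsto (fun R : ℕ => 0 + (expect D (fun k => (k : ℝ) ^ 2) -
      ∑ k ∈ Finset.range (R + 1), (k : ℝ) ^ 2 * (D k).toReal)) atTop (𝓝 0) := by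
    have h1 := ((tendsto_add_atTop_iff_nat 1).2 hd.summable_sq.hasSum.tendsto_sum_nat).const_sub
      (expect D fun k => (k : ℝ) ^ 2)
    rw [← expect, sub_self] at h1
    refine h1.congr fun R => ?_
    rw [zero_add]
    simp only [mul_comm]
  rw [Metric.tendsto_atTop]
  intro ε hε
  obtain ⟨R, hR⟩ := (htail.eventually (Iio_mem_nhds hε)).exists
  rw [← eventually_atTop]
  filter_upwards [(hlim R).eventually (Iio_mem_nhds hR)] with n hn
  rw [Real.dist_eq, sub_zero, abs_of_nonneg (by positivity)]
  exact (hbound R n).trans_lt hn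

theorem Assumption.exists_cycleAsymptotics (hd : Assumption d D) (hν : nu D < 1)
    (hne : ∀ n, Nonempty (PerfectMatching (HalfEdge (d n)))) :
    ∃ ρ, CycleAsymptotics d (nu D) ρ := by
  rcases (expect_nonneg D (f := fun k => (k : ℝ)) fun k => Nat.cast_nonneg k).eq_or_lt' with h0 | h0
  · have : nu D = 0 := by rw [nu, h0, div_zero]
    rw [this]
    exact ⟨0, cycleAsymptotics_of_isEmpty (hd.isEmpty_halfEdge h0) hne⟩
  · have hmdiv : Tendsto (fun n : ℕ => (Nat.card (HalfEdge (d n)) : ℝ) / n) atTop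
        (𝓝 (expect D fun k => (k : ℝ))) := by
      refine hd.tendsto_mean.congr fun n => ?_
      rw [empiricalExpect, card_halfEdge, Nat.cast_sum]
    have hSdiv : Tendsto (fun n : ℕ =>
        (Nat.card (Corner (Sigma.fst : HalfEdge (d n) → Fin n)) : ℝ) / n) atTop
        (𝓝 (expect D fun k => (k : ℝ) * ((k : ℝ) - 1))) := by
      rw [hd.expect_mul_sub_one]
      refine (hd.tendsto_sq.sub hd.tendsto_mean).congr fun n => ?_
      rw [card_corner, sub_div, empiricalExpect, empiricalExpect]
    have hquot : ∀ f : ℕ → ℝ, (fun n : ℕ => f n / n / ((Nat.card (HalfEdge (d n)) : ℝ) / n)) =ᶠ[atTop]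
        fun n => f n / Nat.card (HalfEdge (d n)) := by
      intro f
      filter_upwards [eventually_gt_atTop 0] with n hn
      have : (n : ℝ) ≠ 0 := by exact_mod_cast hn.ne'
      exact div_div_div_cancel_right₀ this _ _
    refine ⟨_, cycleAsymptotics_of_tendsto hne (nu_nonneg D) hν ?_ ?_ ?_⟩
    · rw [← tendsto_natCast_atTop_iff (R := ℝ)]
      refine (hmdiv.pos_mul_atTop h0 tendsto_natCast_atTop_atTop).congr' ?_
      filter_upwards [eventually_gt_atTop 0] with n hn
      have : (n : ℝ) ≠ 0 := by exact_mod_cast hn.ne'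
      exact div_mul_cancel₀ _ this
    · exact (hSdiv.div hmdiv h0.ne').congr' (hquot _)
    · have := (hd.tendsto_sq_maxDeg_div.div hmdiv h0.ne').congr' (hquot _)
      rwa [zero_div] at this

end Assumption

/-! ### Cycles in simple graphs -/

section CycleCopies
variable {V : Type*} {l : ℕ}

theorem cycleGraph_adj_iff_finRotate (hl : 2 ≤ l) {u v : Fin l} :
    (SimpleGraph.cycleGraph l).Adj u v ↔ finRotate l u = v ∨ finRotate l v = u := by
  obtain ⟨n, rfl⟩ : ∃ n, l = n + 2 := ⟨l - 2, by omega⟩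
  rw [SimpleGraph.cycleGraph_adj, finRotate_apply, finRotate_apply, sub_eq_iff_eq_add',
    sub_eq_iff_eq_add', or_comm]
  exact or_congr eq_comm eq_comm

/-- The edges of the closed walk through the given vertices. -/
def cycleEdge (v : Fin l → V) (i : Fin l) : Sym2 V := s(v i, v (finRotate l i))

/-- Two edges of the closed walk could agree only in opposite directions; then two rotation steps
would fix an index, which needs `l ≤ 2`. -/
theorem cycleEdge_injective (hl : 3 ≤ l) {v : Fin l → V} (hv : Function.Injective v) :
    Function.Injective (cycleEdge v) := by
  intro i j h
  rcases Sym2.eq_iff.1 h with h | h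
  · exact hv h.1
  · have h1 := hv h.1
    have h2 := hv h.2
    subst h1
    have := finRotate_pow_inj j (k := 2) (l := 0) (by omega) (by omega) (by simpa [pow_two] using h2)
    omega

/-- The edge sets of the cycles of length `l` of a simple graph. -/
def graphCycles (G : SimpleGraph V) (l : ℕ) : Set (Set (Sym2 V)) :=
  {E | ∃ v : Fin l → V, Function.Injective v ∧ (∀ i, G.Adj (v i) (v (finRotate l i))) ∧
    Set.range (cycleEdge v) = E}

theorem edgeSet_toSubgraph (hl : 2 ≤ l) {G : SimpleGraph V}
    (f : SimpleGraph.Copy (SimpleGraph.cycleGraph l) G) :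
    f.toSubgraph.edgeSet = Set.range (cycleEdge f) := by
  rw [SimpleGraph.Copy.toSubgraph, SimpleGraph.Subgraph.edgeSet_map]
  ext e
  constructor
  · rintro ⟨e, he, rfl⟩
    induction e with
    | _ a b =>
      have : (SimpleGraph.cycleGraph l).Adj a b := by simpa using he
      rcases (cycleGraph_adj_iff_finRotate hl).1 this with rfl | rfl
      · exact ⟨a, rfl⟩
      · exact ⟨b, Sym2.eq_swap⟩
  · rintro ⟨i, rfl⟩
    refine ⟨s(i, finRotate l i), ?_, rfl⟩
    simp only [SimpleGraph.Subgraph.edgeSet_top, SimpleGraph.mem_edgeSet]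
    exact (cycleGraph_adj_iff_finRotate hl).2 (Or.inl rfl)

/-- Copies are counted as subgraphs. Every vertex of a copy of a cycle lies on an edge, so the copy
is determined by its edge set. -/
theorem copyCount_cycleGraph [Fintype V] (hl : 3 ≤ l) (G : SimpleGraph V) :
    G.copyCount (SimpleGraph.cycleGraph l) = (graphCycles G l).ncard := by
  classical
  have h1 : G.copyCount (SimpleGraph.cycleGraph l) = (Set.range (SimpleGraph.Copy.toSubgraph
      (A := SimpleGraph.cycleGraph l) (B := G))).ncard := by
    rw [SimpleGraph.Copy.range_toSubgraph, SimpleGraph.copyCount, Set.ncard_eq_toFinset_card']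
    congr 1
    ext
    simp
  have h2 : SimpleGraph.Subgraph.edgeSet '' (Set.range (SimpleGraph.Copy.toSubgraph
      (A := SimpleGraph.cycleGraph l) (B := G))) = graphCycles G l := by
    ext E
    constructor
    · rintro ⟨_, ⟨f, rfl⟩, rfl⟩
      refine ⟨f, f.injective, fun i => ?_, (edgeSet_toSubgraph (by omega) f).symm⟩
      exact f.toHom.map_adj ((cycleGraph_adj_iff_finRotate (by omega)).2 (Or.inl rfl))
    · rintro ⟨v, hv, hadj, rfl⟩
      let f : SimpleGraph.Copy (SimpleGraph.cycleGraph l) G := ⟨⟨v, fun {a b} hab => by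
        rcases (cycleGraph_adj_iff_finRotate (by omega)).1 hab with rfl | rfl
        · exact hadj a
        · exact (hadj b).symm⟩, hv⟩
      exact ⟨_, ⟨f, rfl⟩, edgeSet_toSubgraph (by omega) f⟩
  rw [h1, ← h2, Set.InjOn.ncard_image]
  rintro _ ⟨f, rfl⟩ _ ⟨g, rfl⟩ h
  have hadj : ∀ x y, f.toSubgraph.Adj x y ↔ g.toSubgraph.Adj x y := by
    intro x y
    rw [← SimpleGraph.Subgraph.mem_edgeSet, h, SimpleGraph.Subgraph.mem_edgeSet]
  have hverts : ∀ f : SimpleGraph.Copy (SimpleGraph.cycleGraph l) G, ∀ x,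
      x ∈ f.toSubgraph.verts ↔ ∃ y, f.toSubgraph.Adj x y := by
    intro f x
    constructor
    · rintro ⟨i, -, rfl⟩
      refine ⟨f (finRotate l i), i, finRotate l i, ?_, rfl, rfl⟩
      exact (cycleGraph_adj_iff_finRotate (by omega)).2 (Or.inl rfl)
    · rintro ⟨y, hy⟩
      exact f.toSubgraph.edge_vert hy
  apply SimpleGraph.Subgraph.ext
  · ext x
    rw [hverts, hverts]
    simp only [hadj]
  · funext x y
    exact propext (hadj x y)

end CycleCopies

/-! ### Simple configurations -/

section Simple
variable {n : ℕ} {d : Fin n → ℕ} {M : Set (Sym2 (HalfEdge d))}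

/-- The multigraph of a configuration has no loops and no parallel edges. -/
structure IsSimpleConfig (M : Set (Sym2 (HalfEdge d))) : Prop where
  ne : ∀ {a b}, s(a, b) ∈ M → a.1 ≠ b.1
  eq : ∀ {a b a' b'}, s(a, b) ∈ M → s(a', b') ∈ M → a.1 = a'.1 → b.1 = b'.1 → a = a'

theorem vec_two_injective {α : Type*} {x y : α} (h : x ≠ y) : Function.Injective ![x, y] := by
  intro i j hij
  fin_cases i <;> fin_cases j
  · rfl
  · exact (h hij).elim
  · exact (h hij.symm).elim
  · rfl

theorem numCycles_eq_zero_iff {V E : Type*} [Finite E] (G : Graph V E) (k : ℕ) :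
    numCycles G k = 0 ↔ ∀ C, ¬ IsCycleEdgeSet G k C := by
  rw [numCycles, Set.ncard_eq_zero (Set.toFinite _), Set.eq_empty_iff_forall_notMem]
  rfl

theorem isSimpleConfig_iff (hM : IsPerfectMatching M) :
    IsSimpleConfig M ↔ (numCycles (multigraph M) 1 = 0 ∧ numCycles (multigraph M) 2 = 0) := by
  rw [numCycles_eq_zero_iff, numCycles_eq_zero_iff]
  constructor
  · intro h
    constructor
    · rintro C ⟨v, e, hv, he, -, hl⟩
      have h1 := hl 0
      obtain ⟨a, b, hab⟩ : ∃ a b, e 0 = s(a, b) := by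
        induction e 0 with
        | _ a b => exact ⟨a, b, rfl⟩
      rw [hab] at h1
      have h2 : s(a.1, b.1) = s(v 0, v 0) := h1.2
      refine h.ne h1.1 ?_
      rcases Sym2.eq_iff.1 h2 with h3 | h3 <;> rw [h3.1, h3.2]
    · rintro C ⟨v, e, hv, he, -, hl⟩
      have hpq : ∀ i, ∃ p q : HalfEdge d, e i = s(p, q) ∧ p.1 = v i ∧ q.1 = v (finRotate 2 i) := by
        intro i
        have h1 := (hl i).2
        induction hei : e i with
        | _ a b =>
          rw [hei] at h1
          rcases Sym2.eq_iff.1 h1 with h | h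
          · exact ⟨a, b, rfl, h.1, h.2⟩
          · exact ⟨b, a, Sym2.eq_swap, h.2, h.1⟩
      obtain ⟨a, b, hab, ha, hb⟩ := hpq 0
      obtain ⟨b', a', hab', hb', ha'⟩ := hpq 1
      have h0 := (hl 0).1
      have h1 := (hl 1).1
      rw [hab] at h0
      rw [hab', Sym2.eq_swap] at h1
      have haa : a = a' := h.eq h0 h1 (ha.trans ha'.symm) (hb.trans hb'.symm)
      subst haa
      have hbb := hM.eq_right h0 h1
      subst hbb
      have := he ((hab.trans Sym2.eq_swap).trans hab'.symm)
      simp at this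
  · rintro ⟨h1, h2⟩
    have hne : ∀ {a b}, s(a, b) ∈ M → a.1 ≠ b.1 := by
      intro a b hab h
      refine h1 _ ⟨fun _ => a.1, fun _ => s(a, b), Function.injective_of_subsingleton _,
        Function.injective_of_subsingleton _, rfl, fun i => ⟨hab, ?_⟩⟩
      rw [Sym2.map_mk, h]
    refine ⟨hne, fun {a b a' b'} hab hab' ha hb => ?_⟩
    by_contra haa
    refine h2 _ ⟨![a.1, b.1], ![s(a, b), s(a', b')], ?_, ?_, rfl, ?_⟩
    · exact vec_two_injective (hne hab)
    · refine vec_two_injective fun h => ?_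
      rcases Sym2.eq_iff.1 h with h | h
      · exact haa h.1
      · exact hne hab (by rw [h.1, ← hb])
    · intro i
      fin_cases i
      · exact ⟨hab, rfl⟩
      · refine ⟨hab', ?_⟩
        have : s(a'.1, b'.1) = s(b.1, a.1) := by rw [← ha, ← hb, Sym2.eq_swap]
        exact this

/-- The simple graph of a configuration. -/
def configGraph (M : Set (Sym2 (HalfEdge d))) : SimpleGraph (Fin n) where
  Adj v w := v ≠ w ∧ ∃ a b, s(a, b) ∈ M ∧ a.1 = v ∧ b.1 = w
  symm := ⟨fun _ _ h => ⟨h.1.symm, by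
    obtain ⟨a, b, hab, ha, hb⟩ := h.2
    exact ⟨b, a, Sym2.eq_swap ▸ hab, hb, ha⟩⟩⟩
  loopless := ⟨fun _ h => h.1 rfl⟩

theorem configGraph_adj_of_mem (hs : IsSimpleConfig M) {a b : HalfEdge d} (h : s(a, b) ∈ M) :
    (configGraph M).Adj a.1 b.1 := ⟨hs.ne h, a, b, h, rfl, rfl⟩

/-- In a simple configuration, forgetting which half-edges are used is injective on the edges of
`M`, hence on sets of such edges. -/
theorem ncard_cycles_eq_graphCycles (hM : IsPerfectMatching M) (hs : IsSimpleConfig M) {l : ℕ}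
    (hl : 3 ≤ l) :
    numCycles (multigraph M) l = (graphCycles (configGraph M) l).ncard := by
  have hinj : Set.InjOn (Sym2.map Sigma.fst) M := by
    intro e he e' he' h
    induction e with
    | _ a b =>
      induction e' with
      | _ a' b' =>
        rcases Sym2.eq_iff.1 h with h | h
        · have h1 : a = a' := hs.eq he he' h.1 h.2
          subst h1
          rw [hM.eq_right he he']
        · rw [Sym2.eq_swap] at he'
          have h1 : a = b' := hs.eq he he' h.1 h.2
          subst h1
          rw [hM.eq_right he he', Sym2.eq_swap]
  have himage : Set.image (Sym2.map Sigma.fst) ''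
      {C | IsCycleEdgeSet (multigraph M) l C} = graphCycles (configGraph M) l := by
    ext E
    constructor
    · rintro ⟨_, ⟨v, e, hv, he, rfl, hl⟩, rfl⟩
      refine ⟨v, hv, fun i => ?_, ?_⟩
      · have h1 := hl i
        obtain ⟨a, b, hab⟩ : ∃ a b, e i = s(a, b) := by
          induction e i with
          | _ a b => exact ⟨a, b, rfl⟩
        rw [hab] at h1
        have h2 := configGraph_adj_of_mem hs h1.1
        rcases Sym2.eq_iff.1 h1.2 with h3 | h3
        · rwa [← h3.1, ← h3.2]
        · rw [← h3.1, ← h3.2]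
          exact h2.symm
      · rw [← Set.range_comp]
        congr 1
        funext i
        exact ((hl i).2).symm
    · rintro ⟨v, hv, hadj, rfl⟩
      have hex : ∀ i, ∃ e ∈ M, e.map Sigma.fst = cycleEdge v i := by
        intro i
        obtain ⟨-, a, b, hab, ha, hb⟩ := hadj i
        exact ⟨_, hab, by rw [Sym2.map_mk, ha, hb]; rfl⟩
      choose e heM he using hex
      refine ⟨Set.range e, ⟨v, e, hv, ?_, rfl, fun i => ⟨heM i, he i⟩⟩, ?_⟩
      · intro i j hij
        apply cycleEdge_injective hl hv
        rw [← he, ← he, hij]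
      · rw [← Set.range_comp]
        congr 1
        funext i
        exact he i
  rw [numCycles, ← himage, Set.InjOn.ncard_image]
  intro C hC C' hC' h
  have hsub : ∀ C ∈ {C | IsCycleEdgeSet (multigraph M) l C}, C ⊆ M := by
    rintro _ ⟨v, e, hv, he, rfl, hl⟩ _ ⟨i, rfl⟩
    exact (hl i).1
  exact (hinj.image_eq_image_iff (hsub C hC) (hsub C' hC')).1 h

theorem copyCount_configGraph (hM : IsPerfectMatching M) (hs : IsSimpleConfig M) {l : ℕ}
    (hl : 3 ≤ l) : (configGraph M).copyCount (SimpleGraph.cycleGraph l) =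
      numCycles (multigraph M) l := by
  rw [copyCount_cycleGraph hl, ncard_cycles_eq_graphCycles hM hs hl]

/-! ### Configurations with a given simple graph -/

/-- The perfect matching given by an involution without fixed points. -/
def involutionPairs {α : Type*} (p : α → α) : Set (Sym2 α) := {e | ∃ a, e = s(a, p a)}

theorem mem_involutionPairs {α : Type*} {p : α → α} (hp : ∀ a, p (p a) = a) {a b : α} :
    s(a, b) ∈ involutionPairs p ↔ p a = b := by
  constructor
  · rintro ⟨c, hc⟩
    rcases Sym2.eq_iff.1 hc with ⟨rfl, rfl⟩ | ⟨rfl, rfl⟩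
    · rfl
    · exact hp _
  · rintro rfl
    exact ⟨a, rfl⟩

theorem isPerfectMatching_involutionPairs {α : Type*} {p : α → α} (hp : ∀ a, p (p a) = a)
    (hne : ∀ a, p a ≠ a) : IsPerfectMatching (involutionPairs p) := by
  refine ⟨?_, fun a => ⟨s(a, p a), ⟨⟨a, rfl⟩, Sym2.mem_mk_left _ _⟩, ?_⟩⟩
  · rintro _ ⟨a, rfl⟩ h
    exact hne a (by simpa [eq_comm] using h)
  · rintro e ⟨he, ha⟩
    obtain ⟨b, rfl⟩ := Sym2.mem_iff_exists.1 ha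
    rw [(mem_involutionPairs hp).1 he]

theorem IsPerfectMatching.partner_partner {α : Type*} {M : Set (Sym2 α)}
    (hM : IsPerfectMatching M) (a : α) : hM.partner (hM.partner a) = a :=
  hM.partner_eq_iff.2 (Sym2.eq_swap ▸ hM.mk_partner_mem a)

/-- The partner of a half-edge for given identifications of the half-edges with neighbours. -/
def graphPartner {G : SimpleGraph (Fin n)} (ψ : ∀ v, Fin (d v) ≃ G.neighborSet v)
    (a : HalfEdge d) : HalfEdge d :=
  ⟨(ψ a.1 a.2).1, (ψ (ψ a.1 a.2).1).symm ⟨a.1, (ψ a.1 a.2).2.symm⟩⟩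

theorem graphPartner_graphPartner {G : SimpleGraph (Fin n)}
    (ψ : ∀ v, Fin (d v) ≃ G.neighborSet v) (a : HalfEdge d) :
    graphPartner ψ (graphPartner ψ a) = a := by
  obtain ⟨v, i⟩ := a
  -- Stated for any neighbour `u` of `w` whose vertex is `v`, so that the equation can be eliminated
  -- although the types of `ψ` and of the half-edges depend on it.
  have h1 : ∀ (w : Fin n) (hw : w ∈ G.neighborSet v) (u : G.neighborSet w) (_ : u.1 = v)
      (hu' : w ∈ G.neighborSet u.1),
      (⟨u.1, (ψ u.1).symm ⟨w, hu'⟩⟩ : HalfEdge d) = ⟨v, (ψ v).symm ⟨w, hw⟩⟩ := by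
    rintro w hw ⟨u, hu⟩ rfl hu'
    rfl
  have h2 := h1 (ψ v i).1 (ψ v i).2
    (ψ (ψ v i).1 ((ψ (ψ v i).1).symm ⟨v, (ψ v i).2.symm⟩)) (by simp)
    (ψ (ψ v i).1 ((ψ (ψ v i).1).symm ⟨v, (ψ v i).2.symm⟩)).2.symm
  refine h2.trans ?_
  simp

theorem graphPartner_fst_ne {G : SimpleGraph (Fin n)} (ψ : ∀ v, Fin (d v) ≃ G.neighborSet v)
    (a : HalfEdge d) : a.1 ≠ (graphPartner ψ a).1 := (ψ a.1 a.2).2.ne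

/-- The configuration of given identifications of the half-edges with neighbours. -/
def graphConfig {G : SimpleGraph (Fin n)} (ψ : ∀ v, Fin (d v) ≃ G.neighborSet v) :
    PerfectMatching (HalfEdge d) :=
  ⟨involutionPairs (graphPartner ψ), isPerfectMatching_involutionPairs
    (graphPartner_graphPartner ψ) fun a h => graphPartner_fst_ne ψ a (congrArg Sigma.fst h.symm)⟩

theorem mem_graphConfig {G : SimpleGraph (Fin n)} (ψ : ∀ v, Fin (d v) ≃ G.neighborSet v)
    {a b : HalfEdge d} : s(a, b) ∈ (graphConfig ψ).1 ↔ graphPartner ψ a = b :=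
  mem_involutionPairs (graphPartner_graphPartner ψ)

theorem isSimpleConfig_graphConfig {G : SimpleGraph (Fin n)}
    (ψ : ∀ v, Fin (d v) ≃ G.neighborSet v) : IsSimpleConfig (graphConfig ψ).1 := by
  refine ⟨fun {a b} h => ?_, fun {a b a' b'} h h' ha hb => ?_⟩
  · rw [mem_graphConfig] at h
    rw [← h]
    exact graphPartner_fst_ne ψ a
  · rw [mem_graphConfig] at h h'
    obtain ⟨v, i⟩ := a
    obtain ⟨v', i'⟩ := a'
    obtain rfl : v = v' := ha
    rw [← h, ← h'] at hb
    have : i = i' := (ψ v).injective (Subtype.ext hb)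
    rw [this]

theorem configGraph_graphConfig {G : SimpleGraph (Fin n)}
    (ψ : ∀ v, Fin (d v) ≃ G.neighborSet v) : configGraph (graphConfig ψ).1 = G := by
  ext v w
  constructor
  · rintro ⟨-, a, b, hab, rfl, rfl⟩
    rw [mem_graphConfig] at hab
    rw [← hab]
    exact (ψ a.1 a.2).2
  · intro h
    have h1 : graphPartner ψ ⟨v, (ψ v).symm ⟨w, h⟩⟩ = ⟨w, (ψ w).symm ⟨v, h.symm⟩⟩ := by
      have : ∀ u : G.neighborSet v, u.1 = w → (⟨u.1, (ψ u.1).symm ⟨v, u.2.symm⟩⟩ : HalfEdge d) =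
          ⟨w, (ψ w).symm ⟨v, h.symm⟩⟩ := by
        rintro ⟨u, hu⟩ rfl
        rfl
      exact this _ (by simp)
    have h2 := configGraph_adj_of_mem (isSimpleConfig_graphConfig ψ) ((mem_graphConfig ψ).2 h1)
    exact h2

/-- The identification of the half-edges at a vertex with its neighbours. -/
def configNeighborEquiv (hM : IsPerfectMatching M) (hs : IsSimpleConfig M) (v : Fin n) :
    Fin (d v) ≃ (configGraph M).neighborSet v :=
  Equiv.ofBijective (fun i => ⟨(hM.partner ⟨v, i⟩).1,
    configGraph_adj_of_mem hs (hM.mk_partner_mem ⟨v, i⟩)⟩) (by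
    constructor
    · intro i j h
      have := hs.eq (hM.mk_partner_mem ⟨v, i⟩) (hM.mk_partner_mem ⟨v, j⟩) rfl
        (congrArg Subtype.val h)
      simpa using this
    · rintro ⟨w, -, ⟨v', i⟩, b, hab, rfl, rfl⟩
      exact ⟨i, Subtype.ext (congrArg Sigma.fst (hM.partner_eq_iff.2 hab))⟩)

theorem configGraph_mem_simpleGraphs (hM : IsPerfectMatching M) (hs : IsSimpleConfig M) :
    configGraph M ∈ simpleGraphs d := by
  classical
  intro v
  rw [← SimpleGraph.card_neighborSet_eq_degree]
  have := Fintype.card_congr (configNeighborEquiv hM hs v)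
  rw [Fintype.card_fin] at this
  rw [this]

theorem graphPartner_configNeighborEquiv (hM : IsPerfectMatching M) (hs : IsSimpleConfig M)
    (a : HalfEdge d) : graphPartner (configNeighborEquiv hM hs) a = hM.partner a := by
  obtain ⟨v, i⟩ := a
  have hadj : v ∈ (configGraph M).neighborSet (hM.partner ⟨v, i⟩).1 :=
    (configGraph_adj_of_mem hs (hM.mk_partner_mem ⟨v, i⟩)).symm
  have h1 : (configNeighborEquiv hM hs (hM.partner ⟨v, i⟩).1).symm ⟨v, hadj⟩ =
      (hM.partner ⟨v, i⟩).2 := by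
    rw [Equiv.symm_apply_eq]
    refine Subtype.ext ?_
    have : (hM.partner (hM.partner ⟨v, i⟩)).1 = v := by rw [hM.partner_partner]
    exact this.symm
  exact Sigma.ext rfl (heq_of_eq h1)

/-- Simple configurations with a given graph are identifications of the half-edges with the
neighbours. -/
def configEquiv (G : SimpleGraph (Fin n)) :
    {M : PerfectMatching (HalfEdge d) // IsSimpleConfig M.1 ∧ configGraph M.1 = G} ≃
      (∀ v, Fin (d v) ≃ G.neighborSet v) where
  toFun M v := (configNeighborEquiv M.1.2 M.2.1 v).trans
    (Equiv.setCongr (congrArg (fun G : SimpleGraph (Fin n) => G.neighborSet v) M.2.2))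
  invFun ψ := ⟨graphConfig ψ, isSimpleConfig_graphConfig ψ, configGraph_graphConfig ψ⟩
  left_inv := by
    rintro ⟨⟨M, hM⟩, hs, rfl⟩
    refine Subtype.ext (Subtype.ext ?_)
    ext e
    induction e with
    | _ a b =>
      rw [mem_graphConfig, ← hM.partner_eq_iff, ← graphPartner_configNeighborEquiv hM hs]
      rfl
  right_inv ψ := by
    funext v
    ext i
    have : (graphConfig ψ).2.partner ⟨v, i⟩ = graphPartner ψ ⟨v, i⟩ :=
      (graphConfig ψ).2.partner_eq_iff.2 ((mem_graphConfig ψ).2 rfl)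
    have h2 := congrArg Sigma.fst this
    exact congrArg Fin.val h2

/-- Such a configuration assigns the half-edges at each vertex bijectively to its neighbours. The
count does not depend on `G`, so conditioning a uniform configuration on simplicity gives a uniform
simple graph. -/
theorem card_config_of_graph {G : SimpleGraph (Fin n)} (hG : G ∈ simpleGraphs d) :
    Nat.card {M : PerfectMatching (HalfEdge d) // IsSimpleConfig M.1 ∧ configGraph M.1 = G} =
      ∏ v, (d v)! := by
  classical
  rw [Nat.card_congr (configEquiv G), Nat.card_pi]
  refine Finset.prod_congr rfl fun v _ => ?_
  have hcard : Fintype.card (Fin (d v)) = Fintype.card (G.neighborSet v) := by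
    rw [SimpleGraph.card_neighborSet_eq_degree, Fintype.card_fin, ← hG v]
  rw [Nat.card_eq_fintype_card, Fintype.card_equiv (Fintype.equivOfCardEq hcard),
    Fintype.card_fin]

theorem card_simple_config (p : SimpleGraph (Fin n) → Prop) :
    Nat.card {M : PerfectMatching (HalfEdge d) // IsSimpleConfig M.1 ∧ p (configGraph M.1)} =
      {G | G ∈ simpleGraphs d ∧ p G}.ncard * ∏ v, (d v)! := by
  rw [← Nat.card_coe_set_eq]
  refine card_eq_card_mul_of_fiber (fun M => (⟨configGraph M.1.1,
    configGraph_mem_simpleGraphs M.1.2 M.2.1, M.2.2⟩ : {G | G ∈ simpleGraphs d ∧ p G})) _ ?_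
  rintro ⟨G, hG, hp⟩
  rw [← card_config_of_graph hG]
  refine Nat.card_congr
    { toFun := fun M => ⟨M.1.1, M.1.2.1, congrArg Subtype.val M.2⟩
      invFun := fun M => ⟨⟨M.1, M.2.1, by rw [M.2.2]; exact hp⟩, Subtype.ext M.2.2⟩
      left_inv := fun _ => rfl
      right_inv := fun _ => rfl }

theorem Feasible.nonempty_perfectMatching (h : Feasible d) :
    Nonempty (PerfectMatching (HalfEdge d)) := by
  obtain ⟨G, hG⟩ := h
  have h1 := card_config_of_graph hG
  have h2 : 0 < ∏ v, (d v)! := Finset.prod_pos fun v _ => Nat.factorial_pos _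
  rw [← h1] at h2
  obtain ⟨M⟩ := (Nat.card_pos_iff.1 h2).1
  exact ⟨M.1⟩

/-- A uniformly random simple graph is a random configuration conditioned on being simple. -/
theorem uniformProb_simpleGraphs (h : Feasible d) (p : SimpleGraph (Fin n) → Prop)
    (q : Set (Sym2 (HalfEdge d)) → Prop)
    (hpq : ∀ M, IsPerfectMatching M → (q M ↔ IsSimpleConfig M ∧ p (configGraph M))) :
    uniformProb (simpleGraphs d) p = uniformProb (configurations d) q /
      uniformProb (configurations d)
        (fun M => numCycles (multigraph M) 1 = 0 ∧ numCycles (multigraph M) 2 = 0) := by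
  have hne := h.nonempty_perfectMatching
  have hc : ((configurations d).ncard : ℝ) ≠ 0 := by
    have : 0 < Nat.card (configurations d) := Nat.card_pos_iff.2 ⟨hne, inferInstance⟩
    rw [Nat.card_coe_set_eq] at this
    exact_mod_cast this.ne'
  have hf : ((∏ v, (d v)! : ℕ) : ℝ) ≠ 0 :=
    Nat.cast_ne_zero.2 (Finset.prod_pos fun v _ => Nat.factorial_pos _).ne'
  have h1 : ∀ (p : SimpleGraph (Fin n) → Prop) (q : Set (Sym2 (HalfEdge d)) → Prop),
      (∀ M, IsPerfectMatching M → (q M ↔ IsSimpleConfig M ∧ p (configGraph M))) →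
      {M | M ∈ configurations d ∧ q M}.ncard = {G | G ∈ simpleGraphs d ∧ p G}.ncard *
        ∏ v, (d v)! := by
    intro p q hpq
    rw [← card_simple_config, ← Nat.card_coe_set_eq]
    refine (Nat.card_congr ((Equiv.subtypeSubtypeEquivSubtypeInter _ _).symm.trans
      (Equiv.subtypeEquivRight fun M => hpq M.1 M.2)))
  have h2 : {G | G ∈ simpleGraphs d ∧ True} = simpleGraphs d := by simp
  -- The choice `p = True` counts all simple configurations; the total number of configurations and
  -- the factor `∏ v, (d v)!` cancel.
  rw [uniformProb, uniformProb, uniformProb, h1 p q hpq, h1 (fun _ => True) _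
    (fun M hM => by rw [isSimpleConfig_iff hM, and_true]), h2, div_div_div_cancel_right₀ hc]
  push_cast
  push_cast at hf
  rw [mul_div_mul_right _ _ hf]

end Simple

/-! ### Limits for simple graphs -/

theorem isAcyclicMultigraph_iff {V E : Type*} [Finite E] (G : Graph V E) :
    IsAcyclicMultigraph G ↔ ∀ l, 1 ≤ l → numCycles G l = 0 :=
  forall₂_congr fun l _ => (numCycles_eq_zero_iff G l).symm

theorem isAcyclic_iff_copyCount {V : Type*} [Fintype V] (G : SimpleGraph V) :
    G.IsAcyclic ↔ ∀ l, 3 ≤ l → G.copyCount (SimpleGraph.cycleGraph l) = 0 := by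
  rw [SimpleGraph.isAcyclic_iff_free_cycleGraph]
  exact forall₂_congr fun l _ => SimpleGraph.copyCount_eq_zero.symm

/-- The sequence `a` with the entries for lengths less than three removed. -/
def truncBelowThree (a : ℕ → ℕ) (l : ℕ) : ℕ := if 3 ≤ l then a l else 0

/-- Prescribing no 1- and 2-cycles encodes simplicity, so the event for simple graphs is an instance
of the one already treated for configurations. -/
theorem forall_numCycles_eq_truncBelowThree_iff {n : ℕ} {d : Fin n → ℕ}
    {M : Set (Sym2 (HalfEdge d))} (hM : IsPerfectMatching M) (a : ℕ → ℕ) :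
    (∀ l, 1 ≤ l → numCycles (multigraph M) l = truncBelowThree a l) ↔
      IsSimpleConfig M ∧
        ∀ l, 3 ≤ l → (configGraph M).copyCount (SimpleGraph.cycleGraph l) = a l := by
  constructor
  · intro h
    have hs : IsSimpleConfig M := (isSimpleConfig_iff hM).2 ⟨h 1 le_rfl, h 2 one_le_two⟩
    refine ⟨hs, fun l hl => ?_⟩
    rw [copyCount_configGraph hM hs hl, h l (by omega), truncBelowThree, if_pos hl]
  · rintro ⟨hs, h⟩ l hl
    rw [truncBelowThree]
    split_ifs with h3
    · rw [← h l h3, copyCount_configGraph hM hs h3]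
    · have h12 := (isSimpleConfig_iff hM).1 hs
      obtain rfl | rfl : l = 1 ∨ l = 2 := by omega
      · exact h12.1
      · exact h12.2

theorem finprod_truncBelowThree (f : ℕ → ℕ → ℝ) (hf : ∀ l, f l 0 = 1) (a : ℕ → ℕ) :
    ∏ᶠ (l : ℕ) (_ : 1 ≤ l), f l (truncBelowThree a l) = ∏ᶠ (l : ℕ) (_ : 3 ≤ l), f l (a l) := by
  refine finprod_congr fun l => ?_
  by_cases h : 3 ≤ l
  · have h1 : 1 ≤ l := by omega
    simp [truncBelowThree, h, h1]
  · simp [truncBelowThree, h, hf]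

variable {d : (n : ℕ) → Fin n → ℕ} {ν ρ : ℝ}

theorem tendsto_uniformProb_simple (h : CycleAsymptotics d ν ρ) :
    Tendsto (fun n => uniformProb (configurations (d n)) (fun M =>
      numCycles (multigraph M) 1 = 0 ∧ numCycles (multigraph M) 2 = 0)) atTop
      (𝓝 (Real.exp (-(ν / 2 + ν ^ 2 / 4)))) := by
  have h1 := tendsto_uniformProb_finset h (A := {1, 2}) (by simp) (fun _ => 0)
  convert! h1 using 2
  · simp
  · rw [Finset.prod_pair (by norm_num), cycleMean, cycleMean]
    simp only [pow_zero, Nat.factorial_zero, Nat.cast_one, div_one, mul_one, Nat.cast_ofNat]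
    rw [← Real.exp_add]
    ring_nf

/-- By conditioning, the probability is the quotient of the one for the truncated sequence by the
probability of simplicity, whose limit is positive. -/
theorem tendsto_uniformProb_simpleGraphs (h : CycleAsymptotics d ν ρ)
    (hf : ∀ n, Feasible (d n)) (a : ℕ → ℕ) (ha : (Function.support a).Finite) :
    Tendsto (fun n => uniformProb (simpleGraphs (d n))
      (fun G => ∀ l, 3 ≤ l → G.copyCount (SimpleGraph.cycleGraph l) = a l)) atTop
      (𝓝 (Real.sqrt (1 - ν) * Real.exp (ν / 2 + ν ^ 2 / 4) * ∏ᶠ (l : ℕ) (_ : 3 ≤ l),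
        (ν ^ l / (2 * (l : ℝ))) ^ (a l) / ((a l)! : ℝ))) := by
  have ha' : (Function.support (truncBelowThree a)).Finite := by
    refine ha.subset fun l hl => ?_
    simp only [Function.mem_support, truncBelowThree] at hl ⊢
    exact fun h0 => hl (by simp [h0])
  have h1 := (tendsto_uniformProb_all h (truncBelowThree a) ha').div
    (tendsto_uniformProb_simple h) (Real.exp_pos _).ne'
  rw [finprod_truncBelowThree (fun l k => (ν ^ l / (2 * (l : ℝ))) ^ k / (k ! : ℝ))
    (fun l => by simp), Real.exp_neg, div_inv_eq_mul, mul_right_comm] at h1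
  refine h1.congr fun n => ?_
  exact (uniformProb_simpleGraphs (hf n) _ _ fun M hM =>
    forall_numCycles_eq_truncBelowThree_iff hM a).symm

end DegSeq

end

/-! ### The main theorem; the acyclic cases are those with `a = 0` -/

theorem mainTheorem7 (d : (n : ℕ) → Fin n → ℕ) (D : PMF ℕ) (hd : DegSeq.Assumption d D)
    (hν : DegSeq.nu D < 1) :
    (∀ a : ℕ → ℕ, (Function.support a).Finite →
      Tendsto (fun n => DegSeq.uniformProb (DegSeq.configurations (d n))
          (fun M => ∀ l, 1 ≤ l → DegSeq.numCycles (DegSeq.multigraph M) l = a l)) atTop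
        (𝓝 (Real.sqrt (1 - DegSeq.nu D) *
          ∏ᶠ (l : ℕ) (_ : 1 ≤ l),
            (DegSeq.nu D ^ l / (2 * (l : ℝ))) ^ (a l) / ((a l)! : ℝ)))) ∧
    Tendsto (fun n => DegSeq.uniformProb (DegSeq.configurations (d n))
        (fun M => DegSeq.IsAcyclicMultigraph (DegSeq.multigraph M))) atTop
      (𝓝 (Real.sqrt (1 - DegSeq.nu D))) ∧
    (∀ a : ℕ → ℕ, (Function.support a).Finite →
      Tendsto (fun n => DegSeq.uniformProb (DegSeq.simpleGraphs (d n))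
          (fun G => ∀ l, 3 ≤ l → G.copyCount (SimpleGraph.cycleGraph l) = a l)) atTop
        (𝓝 (Real.sqrt (1 - DegSeq.nu D) *
          Real.exp (DegSeq.nu D / 2 + DegSeq.nu D ^ 2 / 4) *
          ∏ᶠ (l : ℕ) (_ : 3 ≤ l),
            (DegSeq.nu D ^ l / (2 * (l : ℝ))) ^ (a l) / ((a l)! : ℝ)))) ∧
    Tendsto (fun n => DegSeq.uniformProb (DegSeq.simpleGraphs (d n))
        (fun G => G.IsAcyclic)) atTop
      (𝓝 (Real.sqrt (1 - DegSeq.nu D) *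
        Real.exp (DegSeq.nu D / 2 + DegSeq.nu D ^ 2 / 4))) := by
  obtain ⟨ρ, h⟩ := hd.exists_cycleAsymptotics hν fun n => (hd.feasible n).nonempty_perfectMatching
  have h1 := DegSeq.tendsto_uniformProb_all h
  have h2 := DegSeq.tendsto_uniformProb_simpleGraphs h hd.feasible
  refine ⟨h1, ?_, h2, ?_⟩
  · simpa [DegSeq.isAcyclicMultigraph_iff] using h1 (fun _ => 0) (by simp)
  · simpa [DegSeq.isAcyclic_iff_copyCount] using h2 (fun _ => 0) (by simp)
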